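/- Let $G$ be a compact, simply connected real Lie group, $H\subset G$ a closed connected (Lie) subgroup, with Lie algebras $\mathfrak g,\mathfrak h$, and let $\mathfrak g=\mathfrak h\oplus\mathfrak m$ with $[\mathfrak h,\mathfrak m]\subset\mathfrak m$, $[\mathfrak m,\mathfrak m]\subset\mathfrak h$. Let $\omega_0$ be an $\mathrm{ad}(\mathfrak h)$-invariant non-degenerate skew-symmetric bilinear form on $\mathfrak m$ and $J_0$ an $\mathrm{ad}(\mathfrak h)$-invariant complex structure on $\mathfrak m$ such that $\mathbf g_0(X,Y)=\omega_0(X,J_0Y)$ is an inner product. Fix a unitary basis $X_1,\dots,X_{2n}$ of $\mathfrak m$: $\omega_0(X_j,X_k)=\omega_0(X_{n+j},X_{n+k})=0$, $\omega_0(X_j,X_{n+k})=\delta_{jk}$ and $J_0X_j=X_{n+j}$ for $1\le j,k\le n$. Clifford multiplication by elements of $\mathfrak m$ is the family of unbounded operators on $L^2(\mathbb R^n)$ with domain the Schwartz space $\mathcal S(\mathbb R^n)$ that is real linear in the vector of $\mathfrak m$ and is given by $X_j\cdot f=\mathrm i x_jf$, $X_{n+j}\cdot f=\partial f/\partial x_j$.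 Let $\rho:\mathrm{Mp}(\mathfrak m)\to\mathrm{Sp}(\mathfrak m,\omega_0)$ be the metaplectic group and $\boldsymbol m$ the metaplectic representation on $L^2(\mathbb R^n)$, so that $\rho(a)X\cdot\boldsymbol m(a)f=\boldsymbol m(a)(X\cdot f)$. Let $\tilde\kappa:H\to\mathrm{Mp}(\mathfrak m)$ be a continuous homomorphism lifting the isotropy representation $\kappa(h)=\mathrm{Ad}(h)|_{\mathfrak m}$, i.e. $\rho\circ\tilde\kappa=\kappa$, and put $\lambda=\boldsymbol m\circ\tilde\kappa$. Let $\Gamma(Q)$ be the space of symplectic spinor fields, i.e. of smooth maps $\varphi:G\to L^2(\mathbb R^n)$ with $\varphi(gh)=\lambda(h^{-1})\varphi(g)$ for $g\in G$, $h\in H$. For $X\in\mathfrak m$ let $X(\varphi)$ be the derivative of $\varphi$ along the left-invariant vector field $X$, and let $\nabla\varphi$ be given by $X\mapsto X(\varphi)$. With $\mu$ denoting Clifford multiplication and $\bar\omega,\bar{\mathbf g}:\mathfrak m^*\to\mathfrak m$ the isomorphisms determined by $\omega_0(\bar\omega\alpha,Y)=\alpha(Y)$ and $\mathbf g_0(\bar{\mathbf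 g}\alpha,Y)=\alpha(Y)$, the symplectic Dirac operators are $$\mathcal D=\mu\circ(\bar\omega\otimes\mathrm{id})\circ\nabla,\qquad \tilde{\mathcal D}=\mu\circ(\bar{\mathbf g}\otimes\mathrm{id})\circ\nabla,$$ as operators in $\Gamma(Q)$, defined on those $\varphi\in\Gamma(Q)$ for which $X(\varphi)$ is Schwartz-valued for all $X\in\mathfrak m$ and the result lies in $\Gamma(Q)$. Let $\mathcal P=\mathrm i[\tilde{\mathcal D},\mathcal D]=\mathrm i(\tilde{\mathcal D}\mathcal D-\mathcal D\tilde{\mathcal D})$, with its natural domain. For $l\ge 0$ let $\mathfrak W_l\subset\mathcal S(\mathbb R^n)$ be the span of the Hermite functions $\boldsymbol h_\alpha(x)=\prod_j\boldsymbol h_{\alpha_j}(x_j)$ with $\alpha_1+\dots+\alpha_n=l$, where $\boldsymbol h_k(t)=\mathrm e^{t^2/2}\frac{\mathrm d^k}{\mathrm dt^k}\mathrm e^{-t^2}$. For an irreducible finite-dimensional (smooth) complex representation $\tau_{\mathsf a}:G\to\mathrm{GL}(\mathfrak V_{\mathsf a})$ let $\mathrm{Hom}_H(\mathfrak V_{\mathsf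 a},\mathfrak W_l)$ be the space of linear maps $L:\mathfrak V_{\mathsf a}\to\mathfrak W_l$ with $L\circ\tau_{\mathsf a}(h)=\lambda(h)\circ L$ for $h\in H$, and let $\mathbf U_{\mathsf a}=\sum_{l\ge0}\mathrm{Hom}_H(\mathfrak V_{\mathsf a},\mathfrak W_l)$. Regard $\mathfrak V_{\mathsf a}\otimes\mathbf U_{\mathsf a}$ as a space of functions on $G$ through $(\mathsf v\otimes L)(g)=L(\tau_{\mathsf a}(g^{-1})\mathsf v)$. For a linear map $L:\mathfrak V_{\mathsf a}\to\mathcal S(\mathbb R^n)$ put $$\mathcal D_{\mathsf a}(L)=-\sum_{j=1}^nX_j\cdot L\circ(\tau_{\mathsf a})_*(X_{n+j})+\sum_{j=1}^nX_{n+j}\cdot L\circ(\tau_{\mathsf a})_*(X_j),\qquad \tilde{\mathcal D}_{\mathsf a}(L)=-\sum_{j=1}^{2n}X_j\cdot L\circ(\tau_{\mathsf a})_*(X_j),$$ and $\mathcal P_{\mathsf a}=\mathrm i[\tilde{\mathcal D}_{\mathsf a},\mathcal D_{\mathsf a}]$. Then, for every such $\tau_{\mathsf a}$, the space $\mathfrak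 V_{\mathsf a}\otimes\mathbf U_{\mathsf a}$ is contained in the domains of $\tilde{\mathcal D}$ and $\mathcal P$ and is invariant under $\tilde{\mathcal D}$ and $\mathcal P$. Moreover, $\mathcal D_{\mathsf a}$, $\tilde{\mathcal D}_{\mathsf a}$ and $\mathcal P_{\mathsf a}$ map $\mathbf U_{\mathsf a}$ into itself, and for $\mathsf v\in\mathfrak V_{\mathsf a}$, $L\in\mathbf U_{\mathsf a}$, $$\tilde{\mathcal D}(\mathsf v\otimes L)=\mathsf v\otimes\tilde{\mathcal D}_{\mathsf a}(L),\qquad \mathcal P(\mathsf v\otimes L)=\mathsf v\otimes\mathcal P_{\mathsf a}(L).$$ -/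

import Mathlib

open scoped Manifold ContDiff SchwartzMap TensorProduct

noncomputable section

namespace SympDirac

/-! ### Schwartz functions, square integrable functions and the Schrödinger operators -/

/-- The Hilbert space `L²(ℝⁿ)` of complex valued functions. -/
abbrev L2 (n : ℕ) : Type :=
  MeasureTheory.Lp ℂ 2 (MeasureTheory.volume : MeasureTheory.Measure (Fin n → ℝ))

/-- The space of complex valued Schwartz functions on `ℝⁿ`. -/
abbrev Schw (n : ℕ) : Type := 𝓢(Fin n → ℝ, ℂ)

/-- The inclusion of the Schwartz space into `L²(ℝⁿ)`. -/
def incl (n : ℕ) : Schw n →ₗ[ℂ] L2 n :=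
  (SchwartzMap.toLpCLM ℂ ℂ 2 MeasureTheory.volume : Schw n →L[ℂ] L2 n)

theorem incl_injective (n : ℕ) : Function.Injective (incl n) :=
  SchwartzMap.injective_toLp 2 MeasureTheory.volume

/-- The function `x ↦ exp(i⟨a,x⟩ + (i/2)⟨a,b⟩) f(x + b)`. -/
def weylFun {n : ℕ} (a b : Fin n → ℝ) (f : (Fin n → ℝ) → ℂ) (x : Fin n → ℝ) : ℂ :=
  Complex.exp (Complex.I * ((a ⬝ᵥ x + (a ⬝ᵥ b) / 2 : ℝ) : ℂ)) * f (x + b)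

theorem memLp_weylFun {n : ℕ} (a b : Fin n → ℝ) (f : L2 n) :
    MeasureTheory.MemLp (weylFun a b f) 2 MeasureTheory.volume := by
  have h1 : MeasureTheory.MemLp (fun x => (f : (Fin n → ℝ) → ℂ) (x + b)) 2
      MeasureTheory.volume :=
    (MeasureTheory.Lp.memLp f).comp_measurePreserving
      (MeasureTheory.measurePreserving_add_right MeasureTheory.volume b)
  refine h1.of_le (AEMeasurable.aestronglyMeasurable ?_) (Filter.Eventually.of_forall ?_)
  · have hc : Continuous fun x : Fin n → ℝ =>
        Complex.exp (Complex.I * ((a ⬝ᵥ x + (a ⬝ᵥ b) / 2 : ℝ) : ℂ)) := by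
      unfold dotProduct
      fun_prop
    exact hc.measurable.aemeasurable.mul h1.1.aemeasurable
  · intro x
    rw [weylFun, norm_mul, mul_comm Complex.I, Complex.norm_exp_ofReal_mul_I, one_mul]

/-- The Schrödinger (Weyl) operator `exp(Σ_j (a_j · i x_j + b_j · ∂/∂x_j))` on `L²(ℝⁿ)`. -/
def weyl {n : ℕ} (a b : Fin n → ℝ) (f : L2 n) : L2 n :=
  (memLp_weylFun a b f).toLp

/-- The classical Hermite function `h_l(t) = exp(t²/2) (d/dt)^l exp(-t²)`. -/
def hermite1 (l : ℕ) (t : ℝ) : ℝ :=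
  Real.exp (t ^ 2 / 2) * iteratedDeriv l (fun s => Real.exp (-s ^ 2)) t

/-- The Hermite function `h_α(x) = h_{α₁}(x₁) ⋯ h_{αₙ}(xₙ)`. -/
def hermiteFun {n : ℕ} (α : Fin n → ℕ) (x : Fin n → ℝ) : ℂ :=
  ((∏ j, hermite1 (α j) (x j) : ℝ) : ℂ)

/-- The span `𝔚_l` of the Hermite functions `h_α`, `|α| = l`; these are Schwartz functions. -/
def hermiteSpace (n l : ℕ) : Submodule ℂ (Schw n) :=
  Submodule.span ℂ {f | ∃ α : Fin n → ℕ, ∑ j, α j = l ∧ ∀ x, f x = hermiteFun α x}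

/-- The operators on the Schwartz space by which the members of a symplectic basis act:
`X_j` acts as multiplication by `i x_j`, and `X_{n+j}` acts as `∂/∂x_j`. The indices
`1, …, n` and `n+1, …, 2n` are the left and the right copy of `Fin n`. -/
def cliffordBasis (n : ℕ) : Fin n ⊕ Fin n → (Schw n →ₗ[ℂ] Schw n)
  | Sum.inl j =>
      Complex.I • (SchwartzMap.smulLeftCLM ℂ (fun x : Fin n → ℝ => (x j : ℂ)) :
        Schw n →L[ℂ] Schw n).toLinearMap
  | Sum.inr j =>
      (LineDeriv.lineDerivOpCLM ℂ (Schw n) (Pi.single j (1 : ℝ) : Fin n → ℝ)).toLinearMap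

theorem cliffordBasis_inl_apply (n : ℕ) (j : Fin n) (f : Schw n) (x : Fin n → ℝ) :
    cliffordBasis n (Sum.inl j) f x = Complex.I * (x j : ℂ) * f x := by
  have h : (fun x : Fin n → ℝ => (x j : ℂ)).HasTemperateGrowth :=
    (Complex.ofRealCLM.comp
      (ContinuousLinearMap.proj j : (Fin n → ℝ) →L[ℝ] ℝ)).hasTemperateGrowth
  have h2 := SchwartzMap.smulLeftCLM_apply_apply (F := ℂ) h f x
  simp only [smul_eq_mul] at h2
  change Complex.I * (SchwartzMap.smulLeftCLM ℂ (fun x : Fin n → ℝ => (x j : ℂ)) f) x = _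
  rw [h2, mul_assoc]

theorem cliffordBasis_inr_apply (n : ℕ) (j : Fin n) (f : Schw n) (x : Fin n → ℝ) :
    cliffordBasis n (Sum.inr j) f x = lineDeriv ℝ f x (Pi.single j 1) :=
  SchwartzMap.lineDerivOp_apply (Pi.single j (1 : ℝ) : Fin n → ℝ) f x

/-! ### Partially defined linear operators -/

section PMap

variable {A : Type*} [AddCommGroup A] [Module ℂ A]

/-- The composition `T ∘ S` of unbounded operators, with its natural domain
`{x ∈ dom S | S x ∈ dom T}`. -/
def pcomp (T S : A →ₗ.[ℂ] A) : A →ₗ.[ℂ] A where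
  domain := (T.domain.comap S.toFun).map S.domain.subtype
  toFun :=
    { toFun := fun x => T ⟨S ⟨x.1, by
          obtain ⟨y, _, hy⟩ := x.2
          exact hy ▸ y.2⟩, by
          obtain ⟨x, y, hy, rfl⟩ := x
          exact hy⟩
      map_add' := fun x y => by
        rw [← T.map_add]
        congr 1
        apply Subtype.ext
        simp only [Submodule.coe_add]
        rw [← S.map_add]
        rfl
      map_smul' := fun c x => by
        rw [RingHom.id_apply, ← T.map_smul]
        congr 1
        apply Subtype.ext
        simp only [Submodule.coe_smul]
        rw [← S.map_smul]
        rfl }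

/-- A subspace `W` is invariant under the unbounded operator `T` if it is contained in the domain
of `T` and if `T` maps it into itself. -/
def IsInvariantUnder (W : Submodule ℂ A) (T : A →ₗ.[ℂ] A) : Prop :=
  ∃ h : W ≤ T.domain, ∀ x (hx : x ∈ W), T ⟨x, h hx⟩ ∈ W

end PMap

/-! ### Lie groups -/

section Lie

variable {E : Type*} [NormedAddCommGroup E] [NormedSpace ℝ E]
  {F : Type*} [NormedAddCommGroup F] [NormedSpace ℝ F]
  {G : Type*} [TopologicalSpace G] [ChartedSpace E G] [Group G]

/-- The adjoint representation `Ad(g)`, the differential of `x ↦ g x g⁻¹` at the identity. -/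
def Ad (g : G) : GroupLieAlgebra 𝓘(ℝ, E) G →L[ℝ] GroupLieAlgebra 𝓘(ℝ, E) G :=
  (mfderiv 𝓘(ℝ, E) 𝓘(ℝ, E) (fun x : G => g * x * g⁻¹) 1 : E →L[ℝ] E)

variable (E F) in
/-- The differential at the identity of the inclusion `H → G` of a Lie subgroup. -/
def subgroupDiff (H : Subgroup G) [ChartedSpace F H] : F →L[ℝ] E :=
  mfderiv 𝓘(ℝ, F) 𝓘(ℝ, E) (Subtype.val : H → G) 1

variable (E F) in
/-- The Lie algebra of a Lie subgroup `H` of `G`, as a subspace of the Lie algebra of `G`. -/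
def subgroupLieAlgebra (H : Subgroup G) [ChartedSpace F H] :
    Submodule ℝ (GroupLieAlgebra 𝓘(ℝ, E) G) :=
  LinearMap.range (subgroupDiff E F H).toLinearMap

variable (E F) in
/-- The infinitesimal data that make `G/H` a Hermitian symmetric space: a decomposition
`𝔤 = 𝔥 ⊕ 𝔪` with `[𝔥,𝔪] ⊂ 𝔪` and `[𝔪,𝔪] ⊂ 𝔥`, an `ad(𝔥)`-invariant symplectic form `ω₀` on `𝔪`,
an `ad(𝔥)`-invariant complex structure `J₀` on `𝔪` for which `ω₀(X, J₀ Y)` is an inner product,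
and a unitary basis `X₁, …, X₂ₙ` of `𝔪`. -/
structure HermitianSymmetricData (H : Subgroup G) [ChartedSpace F H] (n : ℕ) where
  m : Submodule ℝ (GroupLieAlgebra 𝓘(ℝ, E) G)
  isCompl : IsCompl (subgroupLieAlgebra E F H) m
  bracket_h_m : ∀ Z ∈ subgroupLieAlgebra E F H, ∀ X ∈ m, ⁅Z, X⁆ ∈ m
  bracket_m_m : ∀ X ∈ m, ∀ Y ∈ m, ⁅X, Y⁆ ∈ subgroupLieAlgebra E F H
  ω₀ : LinearMap.BilinForm ℝ m
  ω₀_isAlt : ω₀.IsAlt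
  ω₀_nondegenerate : ω₀.Nondegenerate
  ω₀_ad_invariant : ∀ (Z : GroupLieAlgebra 𝓘(ℝ, E) G)
    (hZ : Z ∈ subgroupLieAlgebra E F H) (X Y : m),
    ω₀ ⟨⁅Z, (X : GroupLieAlgebra 𝓘(ℝ, E) G)⁆, bracket_h_m Z hZ X X.2⟩ Y
      + ω₀ X ⟨⁅Z, (Y : GroupLieAlgebra 𝓘(ℝ, E) G)⁆, bracket_h_m Z hZ Y Y.2⟩ = 0
  J₀ : m →ₗ[ℝ] m
  J₀_sq : ∀ X, J₀ (J₀ X) = -X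
  J₀_ad_invariant : ∀ (Z : GroupLieAlgebra 𝓘(ℝ, E) G)
    (hZ : Z ∈ subgroupLieAlgebra E F H) (X : m),
    J₀ ⟨⁅Z, (X : GroupLieAlgebra 𝓘(ℝ, E) G)⁆, bracket_h_m Z hZ X X.2⟩
      = ⟨⁅Z, (J₀ X : GroupLieAlgebra 𝓘(ℝ, E) G)⁆, bracket_h_m Z hZ (J₀ X) (J₀ X).2⟩
  g₀_symm : ∀ X Y, ω₀ X (J₀ Y) = ω₀ Y (J₀ X)
  g₀_pos : ∀ X, X ≠ 0 → 0 < ω₀ X (J₀ X)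
  X : Module.Basis (Fin n ⊕ Fin n) ℝ m
  symplectic_inl : ∀ j k, ω₀ (X (Sum.inl j)) (X (Sum.inl k)) = 0
  symplectic_inr : ∀ j k, ω₀ (X (Sum.inr j)) (X (Sum.inr k)) = 0
  symplectic_inl_inr : ∀ j k, ω₀ (X (Sum.inl j)) (X (Sum.inr k)) = if j = k then 1 else 0
  unitary : ∀ j, J₀ (X (Sum.inl j)) = X (Sum.inr j)

namespace HermitianSymmetricData

variable {H : Subgroup G} [ChartedSpace F H] {n : ℕ} (S : HermitianSymmetricData E F H n)

/-- The inner product `g₀(X,Y) = ω₀(X, J₀ Y)` on `𝔪`. -/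
def g₀ : LinearMap.BilinForm ℝ S.m := S.ω₀.compl₂ S.J₀

theorem g₀_nondegenerate : S.g₀.Nondegenerate := by
  refine ⟨fun X hX => ?_, fun X hX => ?_⟩
  · by_contra h
    exact (S.g₀_pos X h).ne' (hX X)
  · by_contra h
    exact (S.g₀_pos X h).ne' (hX X)

/-- The isomorphism `𝔪* → 𝔪` generated by `ω₀`, i.e. `ω₀(ω̄ α, Y) = α(Y)`. -/
def omegaBar : Module.Dual ℝ S.m ≃ₗ[ℝ] S.m :=
  haveI : FiniteDimensional ℝ S.m := S.X.finiteDimensional_of_finite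
  (LinearMap.BilinForm.toDual S.ω₀ S.ω₀_nondegenerate).symm

/-- The isomorphism `𝔪* → 𝔪` given by the inner product `g₀`, i.e. `g₀(ḡ α, Y) = α(Y)`. -/
def gBar : Module.Dual ℝ S.m ≃ₗ[ℝ] S.m :=
  haveI : FiniteDimensional ℝ S.m := S.X.finiteDimensional_of_finite
  (LinearMap.BilinForm.toDual S.g₀ S.g₀_nondegenerate).symm

/-! #### The metaplectic group and the metaplectic representation -/

/-- The Schrödinger operator `exp(Y·)` on `L²(ℝⁿ)` of `Y ∈ 𝔪`. -/
def weylOp (Y : S.m) (f : L2 n) : L2 n :=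
  weyl (fun j => S.X.repr Y (Sum.inl j)) (fun j => S.X.repr Y (Sum.inr j)) f

/-- The group `Mpᶜ(𝔪)` of all pairs `(A, U)` of a symplectic map `A` of `𝔪` and a unitary operator
`U` on `L²(ℝⁿ)` with `U ∘ exp(Y·) ∘ U⁻¹ = exp((AY)·)` for all `Y ∈ 𝔪`. It is a central extension
of `Sp(𝔪)` by the circle. -/
def Mpc : Subgroup ((S.m ≃ₗ[ℝ] S.m) × (L2 n ≃ₗᵢ[ℂ] L2 n)) where
  carrier := {p | (∀ Y Z, S.ω₀ (p.1 Y) (p.1 Z) = S.ω₀ Y Z) ∧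
    ∀ Y f, p.2 (S.weylOp Y f) = S.weylOp (p.1 Y) (p.2 f)}
  one_mem' := ⟨fun _ _ => rfl, fun _ _ => rfl⟩
  mul_mem' := fun {p q} hp hq =>
    ⟨fun Y Z => (hp.1 _ _).trans (hq.1 _ _), fun Y f => by
      change p.2 (q.2 _) = S.weylOp (p.1 (q.1 Y)) (p.2 (q.2 f))
      rw [hq.2, hp.2]⟩
  inv_mem' := fun {p} hp =>
    ⟨fun Y Z => by
      have h := hp.1 (p.1.symm Y) (p.1.symm Z)
      rw [p.1.apply_symm_apply, p.1.apply_symm_apply] at h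
      exact h.symm, fun Y f => by
      change p.2.symm _ = S.weylOp (p.1.symm Y) (p.2.symm f)
      rw [LinearIsometryEquiv.symm_apply_eq, hp.2, p.1.apply_symm_apply,
        p.2.apply_symm_apply]⟩

/-- The metaplectic group `Mp(𝔪)`, realised as the commutator subgroup of `Mpᶜ(𝔪)`. As `Mpᶜ(𝔪)` is
the product of its centre, the circle, and the connected double cover of `Sp(𝔪)`, which is a
perfect group, the commutator subgroup is exactly this double cover. -/
def Mp : Subgroup ((S.m ≃ₗ[ℝ] S.m) × (L2 n ≃ₗᵢ[ℂ] L2 n)) := ⁅S.Mpc, S.Mpc⁆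

/-- The covering homomorphism `ρ` of the metaplectic group onto the symplectic group. -/
def rho : S.Mp →* (S.m ≃ₗ[ℝ] S.m) :=
  (MonoidHom.fst (S.m ≃ₗ[ℝ] S.m) (L2 n ≃ₗᵢ[ℂ] L2 n)).comp S.Mp.subtype

/-- The metaplectic representation of the metaplectic group on `L²(ℝⁿ)`. -/
def metaplecticRep : S.Mp →* (L2 n ≃ₗᵢ[ℂ] L2 n) :=
  (MonoidHom.snd (S.m ≃ₗ[ℝ] S.m) (L2 n ≃ₗᵢ[ℂ] L2 n)).comp S.Mp.subtype

/-- A lift to `Mp(𝔪)` of the isotropy representation `κ(h) = Ad(h)|_𝔪` of `H`: a continuous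
homomorphism `κ̃ : H → Mp(𝔪)` with `ρ ∘ κ̃ = κ`. The topology of `Mp(𝔪)` is that of strong
convergence of the operators on `L²(ℝⁿ)`. -/
structure Lift where
  toHom : H →* S.Mp
  rho_toHom : ∀ (h : H) (Y : S.m),
    ((S.rho (toHom h) Y : S.m) : GroupLieAlgebra 𝓘(ℝ, E) G) = Ad (E := E) (h : G) Y
  continuous_toHom : ∀ f : L2 n, Continuous fun h : H => S.metaplecticRep (toHom h) f

variable {S}

/-- The unitary representation `λ` of `H` on `L²(ℝⁿ)`, the composition of the lift and the
metaplectic representation. -/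
def Lift.lam (κ : S.Lift) : H →* (L2 n ≃ₗᵢ[ℂ] L2 n) := S.metaplecticRep.comp κ.toHom

variable (S)

/-! #### Clifford multiplication -/

/-- Clifford multiplication `Y · f` of Schwartz functions by vectors of `𝔪`. -/
def clifford : S.m →ₗ[ℝ] (Schw n →ₗ[ℂ] Schw n) := S.X.constr ℝ (cliffordBasis n)

/-- Clifford multiplication by `Y` as an unbounded operator on `L²(ℝⁿ)`, with domain the
Schwartz space. -/
def cliffordL2 (Y : S.m) : L2 n →ₗ.[ℂ] L2 n where
  domain := LinearMap.range (incl n)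
  toFun := (incl n ∘ₗ S.clifford Y) ∘ₗ
    (LinearEquiv.ofInjective (incl n) (incl_injective n)).symm.toLinearMap

/-! #### Symplectic spinor fields and symplectic Dirac operators -/

/-- The derivative `Y(φ)` of `φ : G → L²(ℝⁿ)` in the direction of the left invariant vector field
determined by `Y`, so that `∇φ` at the point `gH` is `Y ↦ Y(φ)(g)`. -/
def leftDeriv (Y : GroupLieAlgebra 𝓘(ℝ, E) G) (φ : G → L2 n) (g : G) : L2 n :=
  (mfderiv 𝓘(ℝ, E) 𝓘(ℝ, L2 n) φ g : E →L[ℝ] L2 n) (mulInvariantVectorField Y g)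

variable {S}

/-- The space `Γ(Q)` of symplectic spinor fields: smooth maps `φ : G → L²(ℝⁿ)` such that
`φ(gh) = λ(h⁻¹) φ(g)`. -/
def spinorFields (κ : S.Lift) : Submodule ℂ (G → L2 n) where
  carrier := {φ | ContMDiff 𝓘(ℝ, E) 𝓘(ℝ, L2 n) ∞ φ ∧
    ∀ (g : G) (h : H), φ (g * h) = κ.lam h⁻¹ (φ g)}
  zero_mem' := ⟨contMDiff_const, fun _ _ => (map_zero _).symm⟩
  add_mem' := fun hφ hψ => ⟨hφ.1.add hψ.1, fun g h => by
    simp only [Pi.add_apply, map_add, hφ.2, hψ.2]⟩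
  smul_mem' := fun c φ hφ => by
    refine ⟨?_, fun g h => by simp only [Pi.smul_apply, map_smul, hφ.2]⟩
    have hc : ContMDiff 𝓘(ℝ, L2 n) 𝓘(ℝ, L2 n) ∞ (fun f : L2 n => c • f) :=
      (contDiff_const_smul c).contMDiff
    exact hc.comp hφ.1

theorem leftDeriv_add (κ : S.Lift) (Y : GroupLieAlgebra 𝓘(ℝ, E) G) {φ ψ : G → L2 n}
    (hφ : φ ∈ spinorFields κ) (hψ : ψ ∈ spinorFields κ) (g : G) :
    leftDeriv Y (φ + ψ) g = leftDeriv Y φ g + leftDeriv Y ψ g := by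
  unfold leftDeriv
  rw [mfderiv_add (hφ.1.mdifferentiableAt (by simp)) (hψ.1.mdifferentiableAt (by simp))]
  rfl

theorem leftDeriv_smul (κ : S.Lift) (Y : GroupLieAlgebra 𝓘(ℝ, E) G) (c : ℂ) {φ : G → L2 n}
    (hφ : φ ∈ spinorFields κ) (g : G) :
    leftDeriv Y (c • φ) g = c • leftDeriv Y φ g := by
  have hc : MDifferentiableAt 𝓘(ℝ, L2 n) 𝓘(ℝ, L2 n) (fun f : L2 n => c • f) (φ g) :=
    (differentiableAt_id.const_smul c).mdifferentiableAt
  have h : mfderiv 𝓘(ℝ, E) 𝓘(ℝ, L2 n) ((fun f : L2 n => c • f) ∘ φ) g = _ :=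
    mfderiv_comp g hc (hφ.1.mdifferentiableAt (by simp))
  have hd : fderiv ℝ (fun f : L2 n => c • f) (φ g) = c • ContinuousLinearMap.id ℝ (L2 n) :=
    ((hasFDerivAt_id (φ g)).const_smul c).fderiv
  rw [mfderiv_eq_fderiv, hd] at h
  unfold leftDeriv
  change mfderiv 𝓘(ℝ, E) 𝓘(ℝ, L2 n) ((fun f : L2 n => c • f) ∘ φ) g _ = _
  rw [h]
  rfl

/-- The space of the symplectic spinor fields `φ` for which all Clifford products of `∇φ` with
vectors of `𝔪` are defined. -/
def preDomain (κ : S.Lift) : Submodule ℂ (G → L2 n) where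
  carrier := {φ | φ ∈ spinorFields κ ∧
    ∀ (g : G) (Y : S.m), leftDeriv Y.1 φ g ∈ LinearMap.range (incl n)}
  zero_mem' := ⟨Submodule.zero_mem _, fun g Y => by
    have h := leftDeriv_smul κ Y.1 0 (Submodule.zero_mem (spinorFields κ)) g
    rw [zero_smul, zero_smul] at h
    rw [h]
    exact Submodule.zero_mem _⟩
  add_mem' := fun hφ hψ => ⟨Submodule.add_mem _ hφ.1 hψ.1, fun g Y => by
    rw [leftDeriv_add κ _ hφ.1 hψ.1]
    exact Submodule.add_mem _ (hφ.2 g Y) (hψ.2 g Y)⟩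
  smul_mem' := fun c φ hφ => ⟨Submodule.smul_mem _ c hφ.1, fun g Y => by
    rw [leftDeriv_smul κ _ c hφ.1]
    exact Submodule.smul_mem _ c (hφ.2 g Y)⟩

/-- The derivative `Y(φ)(g)` of a member of `preDomain`, as an element of the domain of the
Clifford multiplications. It depends linearly on `φ`. -/
def preDeriv (κ : S.Lift) (Y : S.m) (g : G) :
    preDomain κ →ₗ[ℂ] LinearMap.range (incl n) where
  toFun φ := ⟨leftDeriv Y.1 φ.1 g, φ.2.2 g Y⟩
  map_add' φ ψ := Subtype.ext (leftDeriv_add κ _ φ.2.1 ψ.2.1 g)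
  map_smul' c φ := Subtype.ext (leftDeriv_smul κ _ c φ.2.1 g)

/-- The operator `μ ∘ (b ⊗ id) ∘ ∇` on symplectic spinor fields, for an isomorphism `b : 𝔪* → 𝔪`.
It is written out by means of `∇φ = Σ_k X_k^* ⊗ ∇_{X_k} φ`, where `X_k^*` is the basis of `𝔪*` dual
to `X_k`. The resulting function is not yet required to be a smooth spinor field. -/
def preDirac (κ : S.Lift) (b : Module.Dual ℝ S.m ≃ₗ[ℝ] S.m) :
    (G → L2 n) →ₗ.[ℂ] (G → L2 n) where
  domain := preDomain κ
  toFun := LinearMap.pi fun g =>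
    ∑ k, (S.cliffordL2 (b (S.X.coord k))).toFun ∘ₗ preDeriv κ (S.X k) g

/-- The operator `μ ∘ (b ⊗ id) ∘ ∇ : Γ(Q) → Γ(Q)`, with its natural domain. -/
def dirac (κ : S.Lift) (b : Module.Dual ℝ S.m ≃ₗ[ℝ] S.m) : (G → L2 n) →ₗ.[ℂ] (G → L2 n) :=
  pcomp ((LinearMap.id : (G → L2 n) →ₗ[ℂ] (G → L2 n)).toPMap (spinorFields κ)) (preDirac κ b)

/-- The first symplectic Dirac operator `𝒟 = μ ∘ (ω̄ ⊗ id) ∘ ∇`. -/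
def diracD (κ : S.Lift) : (G → L2 n) →ₗ.[ℂ] (G → L2 n) := dirac κ S.omegaBar

/-- The second symplectic Dirac operator `𝒟̃ = μ ∘ (ḡ ⊗ id) ∘ ∇`. -/
def diracDTilde (κ : S.Lift) : (G → L2 n) →ₗ.[ℂ] (G → L2 n) := dirac κ S.gBar

/-- The second order operator `𝒫 = i (𝒟̃ 𝒟 - 𝒟 𝒟̃)`, with its natural domain. -/
def opP (κ : S.Lift) : (G → L2 n) →ₗ.[ℂ] (G → L2 n) :=
  Complex.I • (pcomp (diracDTilde κ) (diracD κ) - pcomp (diracD κ) (diracDTilde κ))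

/-! #### Representations of `G` and the spaces `V ⊗ U` -/

variable {V : Type*} [NormedAddCommGroup V] [NormedSpace ℂ V] [FiniteDimensional ℂ V]

/-- The finite-dimensional complex representation `τ` of the Lie group `G` is smooth. -/
def IsSmoothRep (E : Type*) [NormedAddCommGroup E] [NormedSpace ℝ E] [ChartedSpace E G]
    (τ : Representation ℂ G V) : Prop :=
  ContMDiff 𝓘(ℝ, E) 𝓘(ℝ, V →L[ℂ] V) ∞ fun g => LinearMap.toContinuousLinearMap (τ g)

/-- The differential at the identity of the homomorphism `τ : G → GL(V)`. -/
def repDiff (E : Type*) [NormedAddCommGroup E] [NormedSpace ℝ E] [ChartedSpace E G]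
    (τ : Representation ℂ G V) : E →L[ℝ] (V →L[ℂ] V) :=
  mfderiv 𝓘(ℝ, E) 𝓘(ℝ, V →L[ℂ] V) (fun g => LinearMap.toContinuousLinearMap (τ g)) (1 : G)

/-- The differential `τ_*` of the representation `τ` of `G`. -/
def repDeriv (τ : Representation ℂ G V) (Y : GroupLieAlgebra 𝓘(ℝ, E) G) : V →ₗ[ℂ] V :=
  (repDiff E τ Y).toLinearMap

/-- The space `Hom_H(V, 𝔚_l)` of `H`-equivariant linear maps `V → 𝔚_l`. -/
def homH (κ : S.Lift) (τ : Representation ℂ G V) (l : ℕ) : Submodule ℂ (V →ₗ[ℂ] Schw n) where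
  carrier := {L | (∀ v, L v ∈ hermiteSpace n l) ∧
    ∀ (h : H) (v : V), incl n (L (τ h v)) = κ.lam h (incl n (L v))}
  zero_mem' := ⟨fun _ => Submodule.zero_mem _, fun h v => by simp⟩
  add_mem' := fun hL hM => ⟨fun v => Submodule.add_mem _ (hL.1 v) (hM.1 v), fun h v => by
    simp only [LinearMap.add_apply, map_add, hL.2, hM.2]⟩
  smul_mem' := fun c L hL => ⟨fun v => Submodule.smul_mem _ c (hL.1 v), fun h v => by
    simp only [LinearMap.smul_apply, map_smul, hL.2]⟩

/-- The space `U = Σ_l Hom_H(V, 𝔚_l)`. -/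
def spaceU (κ : S.Lift) (τ : Representation ℂ G V) : Submodule ℂ (V →ₗ[ℂ] Schw n) :=
  ⨆ l, homH κ τ l

/-- The map that assigns to `v ⊗ L` the function `g ↦ L(τ(g⁻¹) v)`. -/
def frobenius (n : ℕ) (τ : Representation ℂ G V) :
    V ⊗[ℂ] (V →ₗ[ℂ] Schw n) →ₗ[ℂ] (G → L2 n) :=
  TensorProduct.lift <| LinearMap.mk₂ ℂ (fun v L g => incl n (L (τ g⁻¹ v)))
    (fun v w L => by funext g; simp)
    (fun c v L => by funext g; simp)
    (fun v L M => by funext g; simp)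
    (fun c v L => by funext g; simp)

/-- The space `V ⊗ U`, embedded into the space of functions `G → L²(ℝⁿ)`. -/
def spaceVU (κ : S.Lift) (τ : Representation ℂ G V) : Submodule ℂ (G → L2 n) :=
  LinearMap.range (frobenius n τ ∘ₗ LinearMap.lTensor V (spaceU κ τ).subtype)

variable (S)

/-- `𝒟_τ(L) = - Σ_j X_j · L ∘ τ_*(X_{n+j}) + Σ_j X_{n+j} · L ∘ τ_*(X_j)`. -/
def dRep (τ : Representation ℂ G V) : Module.End ℂ (V →ₗ[ℂ] Schw n) where
  toFun L :=
    - ∑ j, S.clifford (S.X (Sum.inl j)) ∘ₗ L ∘ₗ repDeriv τ (S.X (Sum.inr j)).1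
      + ∑ j, S.clifford (S.X (Sum.inr j)) ∘ₗ L ∘ₗ repDeriv τ (S.X (Sum.inl j)).1
  map_add' L M := by
    simp only [LinearMap.add_comp, LinearMap.comp_add, Finset.sum_add_distrib]
    abel
  map_smul' c L := by
    simp only [LinearMap.smul_comp, LinearMap.comp_smul, ← Finset.smul_sum, RingHom.id_apply,
      smul_add, smul_neg]

/-- `𝒟̃_τ(L) = - Σ_{k=1}^{2n} X_k · L ∘ τ_*(X_k)`. -/
def dTildeRep (τ : Representation ℂ G V) : Module.End ℂ (V →ₗ[ℂ] Schw n) where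
  toFun L := - ∑ k, S.clifford (S.X k) ∘ₗ L ∘ₗ repDeriv τ (S.X k).1
  map_add' L M := by
    simp only [LinearMap.add_comp, LinearMap.comp_add, Finset.sum_add_distrib]
    abel
  map_smul' c L := by
    simp only [LinearMap.smul_comp, LinearMap.comp_smul, ← Finset.smul_sum, RingHom.id_apply,
      smul_neg]

/-- `𝒫_τ = i [𝒟̃_τ, 𝒟_τ]`. -/
def pRep (τ : Representation ℂ G V) : Module.End ℂ (V →ₗ[ℂ] Schw n) :=
  Complex.I • ⁅S.dTildeRep τ, S.dRep τ⁆

end HermitianSymmetricData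

end Lie

end SympDirac

end

open SympDirac SympDirac.HermitianSymmetricData

noncomputable section

namespace SympDirac

open Filter Topology

/-! ### Calculus of a local group law -/

section LocalGroup

variable {E : Type*} [NormedAddCommGroup E] [NormedSpace ℝ E]

/-! The field of `v ⊗ L` is `g ↦ L(τ(g⁻¹)v)`, and its derivative along a left invariant `Y` is
`-L(τ_*(Y) τ(g⁻¹)v)` (`leftDeriv_matrixField`). It is therefore Schwartz-valued, and `μ ∘ (b ⊗ id) ∘
∇` acts on the factor `L` alone, through `L ↦ -Σ_k b(X^k) · L ∘ τ_*(X_k)` (`diracRep`,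
`dirac_matrixField`). In the unitary basis this is `𝒟_τ` for `b = ω̄` and `𝒟̃_τ` for `b = ḡ`. To
stay in `Γ(Q)`, and to iterate as `𝒫` requires, the new map must again be `H`-equivariant; to stay
in `U`, it must also respect the Hermite grading.

Equivariance (`diracRep_equivariant`) holds because `Σ_k X^k ⊗ X_k` is canonical, hence fixed by
`κ(h)`, once three intertwining properties are known. Clifford multiplication satisfies `λ(h)(Y·f) =
κ(h)Y·λ(h)f` (`lam_clifford`), which is the defining relation of `Mpᶜ` with the Weyl operators,
differentiated weakly. The differential satisfies `τ(h)τ_*(Y) = τ_*(Ad(h)Y)τ(h)` (`repDeriv_Ad`).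
Finally `b` commutes with `κ(h)`: for `ω̄` because `κ(h)` is symplectic, for `ḡ` because `κ(h)`
preserves `g₀` (`g₀_isotropy`). The last point is given only infinitesimally; passing to the group
uses that the differential of `Ad` is the Lie bracket (`hasMFDerivAt_Ad`) and that `H` is connected.

For the grading, `𝒟̃_τ + i𝒟_τ` involves only the creation operators `∂_j - x_j`, and `𝒟̃_τ - i𝒟_τ`
only the annihilation operators `∂_j + x_j`. They send `Hom_H(V, 𝔚_l)` to degrees `l+1` and `l-1`,
so both Dirac operators preserve the sum `U` though not its summands (`dRep_dTildeRep_mem_spaceU`).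
-/

theorem hasFDerivAt_fderiv_comp_apply {f : E × E → E} {p : E → E × E} {e : E}
    (hf : ContDiffAt ℝ 2 f (p e)) (hp : DifferentiableAt ℝ p e) (w : E × E) :
    HasFDerivAt (fun a => fderiv ℝ f (p a) w)
      (((fderiv ℝ (fderiv ℝ f) (p e)).comp (fderiv ℝ p e)).flip w) e := by
  have h1 : DifferentiableAt ℝ (fderiv ℝ f) (p e) :=
    (hf.fderiv_right (m := 1) (by norm_num)).differentiableAt (by norm_num)
  have h2 := (h1.hasFDerivAt.comp e hp.hasFDerivAt).clm_apply (hasFDerivAt_const w e)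
  convert! h2 using 1
  ext z
  simp

/-- For a local group law `M` with unit `e` and its conjugation map `c`, the derivative at the unit
of the adjoint representation is the commutator of left invariant vector fields. -/
theorem fderiv_localAd {M c : E × E → E} {e : E}
    (hM : ContDiffAt ℝ 2 M (e, e)) (hc : ContDiffAt ℝ 2 c (e, e))
    (hM1 : ∀ᶠ a in 𝓝 e, M (a, e) = a)
    (hc1 : ∀ᶠ a in 𝓝 e, c (a, e) = e) (hc2 : ∀ᶠ u in 𝓝 e, c (e, u) = u)
    (hMc : ∀ᶠ p in 𝓝 (e, e), M (c p, p.1) = M p) (X : E) :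
    DifferentiableAt ℝ (fun a => fderiv ℝ c (a, e) (0, X)) e ∧
    ∀ Z, fderiv ℝ (fun a => fderiv ℝ c (a, e) (0, X)) e Z =
      fderiv ℝ (fun a => fderiv ℝ M (a, e) (0, X)) e Z
        - fderiv ℝ (fun a => fderiv ℝ M (a, e) (0, Z)) e X := by
  have hl : HasFDerivAt (fun a : E => (a, e)) (ContinuousLinearMap.inl ℝ E E) e :=
    (hasFDerivAt_id e).prodMk (hasFDerivAt_const e e)
  have hr : HasFDerivAt (fun a : E => (e, a)) (ContinuousLinearMap.inr ℝ E E) e :=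
    (hasFDerivAt_const e e).prodMk (hasFDerivAt_id e)
  have hC := hasFDerivAt_fderiv_comp_apply (p := fun a => (a, e)) hc hl.differentiableAt (0, X)
  refine ⟨hC.differentiableAt, fun Z => ?_⟩
  rw [(hasFDerivAt_fderiv_comp_apply (p := fun a => (a, e)) hM hl.differentiableAt (0, X)).fderiv,
    (hasFDerivAt_fderiv_comp_apply (p := fun a => (a, e)) hM hl.differentiableAt (0, Z)).fderiv]
  have hct : Tendsto (fun a : E => (a, e)) (𝓝 e) (𝓝 (e, e)) := hl.continuousAt
  have hct' : Tendsto (fun a : E => (e, a)) (𝓝 e) (𝓝 (e, e)) := hr.continuousAt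
  have hMd : ∀ᶠ p in 𝓝 (e, e), DifferentiableAt ℝ M p :=
    (hM.eventually (by simp)).mono fun p hp => hp.differentiableAt (by norm_num)
  have hcd : ∀ᶠ p in 𝓝 (e, e), DifferentiableAt ℝ c p :=
    (hc.eventually (by simp)).mono fun p hp => hp.differentiableAt (by norm_num)
  -- This is `(a u a⁻¹) a = a u` differentiated in `u` at the unit, for each `a` near the unit.
  have key : (fun a => fderiv ℝ M (e, a) (fderiv ℝ c (a, e) (0, X), 0)) =ᶠ[𝓝 e]
      fun a => fderiv ℝ M (a, e) (0, X) := by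
    filter_upwards [hct.eventually hMc.eventually_nhds, hct.eventually hMd, hct'.eventually hMd,
      hct.eventually hcd, hc1] with a h1 h2 h3 h4 h5
    have hra : HasFDerivAt (fun u : E => (a, u)) (ContinuousLinearMap.inr ℝ E E) e :=
      (hasFDerivAt_const a e).prodMk (hasFDerivAt_id e)
    have hra' : Tendsto (fun u : E => (a, u)) (𝓝 e) (𝓝 (a, e)) := hra.continuousAt
    have e1 : HasFDerivAt (fun u => M (a, u)) _ e := h2.hasFDerivAt.comp e hra
    have e2 : HasFDerivAt (fun u => (c (a, u), a)) _ e :=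
      (h4.hasFDerivAt.comp e hra).prodMk (hasFDerivAt_const a e)
    have h3' : HasFDerivAt M (fderiv ℝ M (e, a)) (c (a, e), a) := by
      rw [h5]; exact h3.hasFDerivAt
    have e3 : HasFDerivAt (fun u => M (c (a, u), a)) _ e := HasFDerivAt.comp (g := M) e h3' e2
    have e4 := e3.unique (e1.congr_of_eventuallyEq (hra'.eventually h1))
    have := DFunLike.congr_fun e4 X
    simpa using this
  have hCe : fderiv ℝ c (e, e) (0, X) = X := by
    have e1 : HasFDerivAt (fun u => c (e, u)) _ e := hcd.self_of_nhds.hasFDerivAt.comp e hr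
    have e2 : HasFDerivAt (fun u => c (e, u)) (ContinuousLinearMap.id ℝ E) e :=
      (hasFDerivAt_id e).congr_of_eventuallyEq hc2
    simpa using DFunLike.congr_fun (e1.unique e2) X
  have hMe : ∀ w, fderiv ℝ M (e, e) (w, 0) = w := fun w => by
    have e1 : HasFDerivAt (fun u => M (u, e)) _ e :=
      HasFDerivAt.comp (f := fun u => (u, e)) e hMd.self_of_nhds.hasFDerivAt hl
    have e2 : HasFDerivAt (fun u => M (u, e)) (ContinuousLinearMap.id ℝ E) e :=
      (hasFDerivAt_id e).congr_of_eventuallyEq hM1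
    simpa using DFunLike.congr_fun (e1.unique e2) w
  have hA := hasFDerivAt_fderiv_comp_apply (p := fun a => (a, e)) hM hl.differentiableAt (0, X)
  have h1 : DifferentiableAt ℝ (fderiv ℝ M) (e, e) :=
    (hM.fderiv_right (m := 1) (by norm_num)).differentiableAt (by norm_num)
  -- Differentiating `key` in `a`, the product rule gives the derivative of `Ad` plus a mixed second
  -- derivative of `M`.
  have h2 : HasFDerivAt (fun a => fderiv ℝ M (e, a) (fderiv ℝ c (a, e) (0, X), 0)) _ e :=
    HasFDerivAt.clm_apply (h1.hasFDerivAt.comp e hr)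
      (hC.prodMk (hasFDerivAt_const (0 : E) e))
  have h3 := DFunLike.congr_fun (h2.unique (hA.congr_of_eventuallyEq key)) Z
  -- Symmetry of the second derivative turns the mixed term into the derivative along `X` of the
  -- left invariant field of `Z`.
  have hs := (hM.isSymmSndFDerivAt (by simp)).eq (0, Z) (X, 0)
  rw [hC.fderiv]
  simp only [hl.fderiv] at h3 ⊢
  simp [hCe, hMe, hs] at h3 ⊢
  rw [← h3]
  abel

end LocalGroup

end SympDirac
end

noncomputable section

namespace SympDirac

open Filter Topology VectorField

/-! ### The adjoint representation and the Lie bracket in the chart at the unit -/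

section LieGroupChart

variable {E : Type*} [NormedAddCommGroup E] [NormedSpace ℝ E]
  {G : Type*} [TopologicalSpace G] [ChartedSpace E G] [Group G]

variable (E G) in
/-- The coordinates of the unit of a Lie group. -/
def chartOne : E := extChartAt 𝓘(ℝ, E) (1 : G) 1

variable (E G) in
/-- The group multiplication in the chart at the unit. -/
def chartMul (p : E × E) : E :=
  extChartAt 𝓘(ℝ, E) (1 : G)
    ((extChartAt 𝓘(ℝ, E) (1 : G)).symm p.1 * (extChartAt 𝓘(ℝ, E) (1 : G)).symm p.2)

variable (E G) in
/-- The conjugation of group elements in the chart at the unit. -/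
def chartConj (p : E × E) : E :=
  extChartAt 𝓘(ℝ, E) (1 : G)
    ((extChartAt 𝓘(ℝ, E) (1 : G)).symm p.1 * (extChartAt 𝓘(ℝ, E) (1 : G)).symm p.2 *
      ((extChartAt 𝓘(ℝ, E) (1 : G)).symm p.1)⁻¹)

variable (E G) in
theorem chartSymm_one : (extChartAt 𝓘(ℝ, E) (1 : G)).symm (chartOne E G) = 1 :=
  extChartAt_to_inv 1

variable (E G) in
theorem eventually_mem_chartTarget :
    ∀ᶠ a in 𝓝 (chartOne E G), a ∈ (extChartAt 𝓘(ℝ, E) (1 : G)).target :=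
  extChartAt_target_mem_nhds (I := 𝓘(ℝ, E)) (1 : G)

omit [Group G] in
-- The manifold derivative is by definition the derivative in the preferred charts. The target chart
-- is centred at a separate `y`, so that points such as `g * 1` can be replaced by `g` without
-- rewriting inside dependent types.
theorem mfderiv_eq_fderiv {E' : Type*} [NormedAddCommGroup E'] [NormedSpace ℝ E']
    {M : Type*} [TopologicalSpace M] [ChartedSpace E' M] {f : M → G} {x : M}
    (hf : MDifferentiableAt 𝓘(ℝ, E') 𝓘(ℝ, E) f x) {y : G} (hy : f x = y) (v : E') :
    (mfderiv 𝓘(ℝ, E') 𝓘(ℝ, E) f x v : E) =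
      fderiv ℝ (fun u => extChartAt 𝓘(ℝ, E) y (f ((extChartAt 𝓘(ℝ, E') x).symm u)))
        (extChartAt 𝓘(ℝ, E') x x) v := by
  subst hy
  have h : ∀ (φ : E' → E) (A : E' →L[ℝ] E) (p : E'),
      HasFDerivWithinAt φ A (Set.range 𝓘(ℝ, E')) p → A v = fderiv ℝ φ p v := fun φ A p hA => by
    rw [modelWithCornersSelf_coe, Set.range_id, hasFDerivWithinAt_univ] at hA
    rw [hA.fderiv]
  exact h _ _ _ hf.hasMFDerivAt.2

omit [Group G] in
/-- The Lie bracket of vector fields in the chart. -/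
theorem mlieBracket_eq_lieBracket [IsManifold 𝓘(ℝ, E) 1 G] (V W : ∀ x : G, TangentSpace 𝓘(ℝ, E) x) (x : G) :
    (mlieBracket 𝓘(ℝ, E) V W x : E) = lieBracket ℝ
      (mpullbackWithin 𝓘(ℝ, E) 𝓘(ℝ, E) (extChartAt 𝓘(ℝ, E) x).symm V Set.univ : E → E)
      (mpullbackWithin 𝓘(ℝ, E) 𝓘(ℝ, E) (extChartAt 𝓘(ℝ, E) x).symm W Set.univ : E → E)
      (extChartAt 𝓘(ℝ, E) x x) := by
  have h1 : ∀ w : E, ((mfderiv 𝓘(ℝ, E) 𝓘(ℝ, E) (extChartAt 𝓘(ℝ, E) x) x).inverse w : E) = w := by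
    intro w
    rw [mfderiv_extChartAt_self]
    exact DFunLike.congr_fun (ContinuousLinearMap.inverse_id (R := ℝ) (M := E)) w
  -- The range of the model is the whole space only up to a proof, so it is generalised to a set `s`
  -- that can be substituted.
  have h3 : ∀ s : Set E, s = Set.univ → lieBracketWithin ℝ
      (mpullbackWithin 𝓘(ℝ, E) 𝓘(ℝ, E) (extChartAt 𝓘(ℝ, E) x).symm V s : E → E)
      (mpullbackWithin 𝓘(ℝ, E) 𝓘(ℝ, E) (extChartAt 𝓘(ℝ, E) x).symm W s : E → E)
      ((extChartAt 𝓘(ℝ, E) x).symm ⁻¹' Set.univ ∩ s) (extChartAt 𝓘(ℝ, E) x x) = lieBracket ℝ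
      (mpullbackWithin 𝓘(ℝ, E) 𝓘(ℝ, E) (extChartAt 𝓘(ℝ, E) x).symm V Set.univ : E → E)
      (mpullbackWithin 𝓘(ℝ, E) 𝓘(ℝ, E) (extChartAt 𝓘(ℝ, E) x).symm W Set.univ : E → E)
      (extChartAt 𝓘(ℝ, E) x x) := by
    rintro _ rfl
    rw [Set.preimage_univ, Set.inter_univ]
    exact congrFun lieBracketWithin_univ _
  exact (h1 _).trans (h3 _ Set.range_id)

variable [LieGroup 𝓘(ℝ, E) ∞ G]

variable (E G) in
theorem contMDiffAt_chartSymm : ContMDiffAt 𝓘(ℝ, E) 𝓘(ℝ, E) ∞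
    (extChartAt 𝓘(ℝ, E) (1 : G)).symm (chartOne E G) :=
  have : IsManifold 𝓘(ℝ, E) ∞ G := ContMDiffMul.toIsManifold
  (contMDiffOn_extChartAt_symm (1 : G)).contMDiffAt (extChartAt_target_mem_nhds (1 : G))

variable (E G) in
theorem contDiffAt_chartMul : ContDiffAt ℝ ∞ (chartMul E G) (chartOne E G, chartOne E G) := by
  have h1 : ContMDiffAt 𝓘(ℝ, E × E) 𝓘(ℝ, E) ∞
      (fun p : E × E => (extChartAt 𝓘(ℝ, E) (1 : G)).symm p.1) (chartOne E G, chartOne E G) :=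
    ContMDiffAt.comp (g := (extChartAt 𝓘(ℝ, E) (1 : G)).symm) _ (contMDiffAt_chartSymm E G)
      contDiffAt_fst.contMDiffAt
  have h2 : ContMDiffAt 𝓘(ℝ, E × E) 𝓘(ℝ, E) ∞
      (fun p : E × E => (extChartAt 𝓘(ℝ, E) (1 : G)).symm p.2) (chartOne E G, chartOne E G) :=
    ContMDiffAt.comp (g := (extChartAt 𝓘(ℝ, E) (1 : G)).symm) _ (contMDiffAt_chartSymm E G)
      contDiffAt_snd.contMDiffAt
  refine contMDiffAt_iff_contDiffAt.1 (ContMDiffAt.comp (g := extChartAt 𝓘(ℝ, E) (1 : G)) _ ?_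
    (h1.mul h2))
  simp only [chartSymm_one, mul_one]
  exact contMDiffAt_extChartAt

variable (E G) in
theorem contDiffAt_chartConj : ContDiffAt ℝ ∞ (chartConj E G) (chartOne E G, chartOne E G) := by
  have h1 : ContMDiffAt 𝓘(ℝ, E × E) 𝓘(ℝ, E) ∞
      (fun p : E × E => (extChartAt 𝓘(ℝ, E) (1 : G)).symm p.1) (chartOne E G, chartOne E G) :=
    ContMDiffAt.comp (g := (extChartAt 𝓘(ℝ, E) (1 : G)).symm) _ (contMDiffAt_chartSymm E G)
      contDiffAt_fst.contMDiffAt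
  have h2 : ContMDiffAt 𝓘(ℝ, E × E) 𝓘(ℝ, E) ∞
      (fun p : E × E => (extChartAt 𝓘(ℝ, E) (1 : G)).symm p.2) (chartOne E G, chartOne E G) :=
    ContMDiffAt.comp (g := (extChartAt 𝓘(ℝ, E) (1 : G)).symm) _ (contMDiffAt_chartSymm E G)
      contDiffAt_snd.contMDiffAt
  refine contMDiffAt_iff_contDiffAt.1 (ContMDiffAt.comp (g := extChartAt 𝓘(ℝ, E) (1 : G)) _ ?_
    ((h1.mul h2).mul h1.inv))
  simp only [chartSymm_one, mul_one, inv_one]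
  exact contMDiffAt_extChartAt

variable (E G) in
omit [LieGroup 𝓘(ℝ, E) ∞ G] in
theorem chartMul_one : ∀ᶠ a in 𝓝 (chartOne E G), chartMul E G (a, chartOne E G) = a := by
  filter_upwards [eventually_mem_chartTarget E G] with a ha
  simp only [chartMul, chartSymm_one, mul_one]
  exact (extChartAt 𝓘(ℝ, E) (1 : G)).right_inv ha

variable (E G) in
omit [LieGroup 𝓘(ℝ, E) ∞ G] in
theorem chartMul_one_left : ∀ᶠ u in 𝓝 (chartOne E G), chartMul E G (chartOne E G, u) = u := by
  filter_upwards [eventually_mem_chartTarget E G] with a ha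
  simp only [chartMul, chartSymm_one, one_mul]
  exact (extChartAt 𝓘(ℝ, E) (1 : G)).right_inv ha

variable (E G) in
omit [LieGroup 𝓘(ℝ, E) ∞ G] in
theorem chartConj_one (a : E) : chartConj E G (a, chartOne E G) = chartOne E G := by
  simp only [chartConj, chartSymm_one, mul_one, mul_inv_cancel]
  rfl

variable (E G) in
omit [LieGroup 𝓘(ℝ, E) ∞ G] in
theorem chartConj_one_left : ∀ᶠ u in 𝓝 (chartOne E G), chartConj E G (chartOne E G, u) = u := by
  filter_upwards [eventually_mem_chartTarget E G] with a ha
  simp only [chartConj, chartSymm_one, mul_one, inv_one, one_mul]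
  exact (extChartAt 𝓘(ℝ, E) (1 : G)).right_inv ha

variable (E G) in
-- The relation `(a u a⁻¹) a = a u` survives in coordinates as long as `a u a⁻¹` stays in the chart
-- domain, which holds near the unit by continuity.
theorem eventually_chartMul_chartConj :
    ∀ᶠ p in 𝓝 (chartOne E G, chartOne E G),
      chartMul E G (chartConj E G p, p.1) = chartMul E G p := by
  have h1 : ContinuousAt (fun p : E × E => (extChartAt 𝓘(ℝ, E) (1 : G)).symm p.1)
      (chartOne E G, chartOne E G) :=
    ContinuousAt.comp (g := (extChartAt 𝓘(ℝ, E) (1 : G)).symm)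
      (contMDiffAt_chartSymm E G).continuousAt continuousAt_fst
  have h2 : ContinuousAt (fun p : E × E => (extChartAt 𝓘(ℝ, E) (1 : G)).symm p.2)
      (chartOne E G, chartOne E G) :=
    ContinuousAt.comp (g := (extChartAt 𝓘(ℝ, E) (1 : G)).symm)
      (contMDiffAt_chartSymm E G).continuousAt continuousAt_snd
  have : IsTopologicalGroup G := topologicalGroup_of_lieGroup 𝓘(ℝ, E) ∞
  have h3 := (h1.mul h2).mul h1.inv
  have h4 : ∀ᶠ p in 𝓝 (chartOne E G, chartOne E G),
      (extChartAt 𝓘(ℝ, E) (1 : G)).symm p.1 * (extChartAt 𝓘(ℝ, E) (1 : G)).symm p.2 *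
      ((extChartAt 𝓘(ℝ, E) (1 : G)).symm p.1)⁻¹ ∈ (extChartAt 𝓘(ℝ, E) (1 : G)).source := by
    refine h3.eventually_mem ?_
    simp only [Pi.mul_apply, Pi.inv_apply, chartSymm_one, mul_one, inv_one]
    exact extChartAt_source_mem_nhds (1 : G)
  filter_upwards [h4] with p hp
  simp only [chartMul, chartConj]
  rw [(extChartAt 𝓘(ℝ, E) (1 : G)).left_inv hp, inv_mul_cancel_right]

theorem mdifferentiableAt_mul_left (g h : G) :
    MDifferentiableAt 𝓘(ℝ, E) 𝓘(ℝ, E) (fun x : G => g * x) h :=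
  (contMDiff_mul_left (I := 𝓘(ℝ, E)) (n := ∞) (a := g)).mdifferentiable (by simp) h

theorem mdifferentiableAt_conj (g h : G) :
    MDifferentiableAt 𝓘(ℝ, E) 𝓘(ℝ, E) (fun x : G => g * x * g⁻¹) h :=
  (((contMDiff_mul_right (I := 𝓘(ℝ, E)) (n := ∞) (a := g⁻¹)).comp
    (contMDiff_mul_left (I := 𝓘(ℝ, E)) (n := ∞) (a := g))).mdifferentiable (by simp) h)

theorem hasFDerivAt_partial {f : E × E → E} {a e : E} (hf : DifferentiableAt ℝ f (a, e)) :
    HasFDerivAt (fun u => f (a, u)) ((fderiv ℝ f (a, e)).comp (ContinuousLinearMap.inr ℝ E E)) e :=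
  HasFDerivAt.comp (f := fun u => (a, u)) e hf.hasFDerivAt
    ((hasFDerivAt_const a e).prodMk (hasFDerivAt_id e))

theorem Ad_eventuallyEq (X : E) :
    (fun g : G => (Ad (E := E) g X : E)) =ᶠ[𝓝 1] fun g =>
      fderiv ℝ (chartConj E G) (extChartAt 𝓘(ℝ, E) (1 : G) g, chartOne E G) (0, X) := by
  have hc : ∀ᶠ p in 𝓝 (chartOne E G, chartOne E G), DifferentiableAt ℝ (chartConj E G) p :=
    (((contDiffAt_chartConj E G).of_le (m := 1) (by simp)).eventually (by simp)).mono fun p hp =>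
      hp.differentiableAt (by norm_num)
  have ht : Tendsto (fun g : G => (extChartAt 𝓘(ℝ, E) (1 : G) g, chartOne E G)) (𝓝 1)
      (𝓝 (chartOne E G, chartOne E G)) :=
    (continuousAt_extChartAt (1 : G)).prodMk continuousAt_const
  filter_upwards [ht.eventually hc, extChartAt_source_mem_nhds (I := 𝓘(ℝ, E)) (1 : G)] with g h1 h2
  have h3 := mfderiv_eq_fderiv (mdifferentiableAt_conj (E := E) g 1) (y := 1) (by simp) X
  have h4 := (hasFDerivAt_partial h1).fderiv
  simp only [chartConj, (extChartAt 𝓘(ℝ, E) (1 : G)).left_inv h2] at h4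
  exact h3.trans (DFunLike.congr_fun h4 X)

/-- In the chart at the unit, `u ↦ chartMul (a, u)` is left translation, so its derivative at the
unit gives the invariant field. The manifold derivative at `g` uses the chart at `g` instead; the
transition map to that chart enters both the field and the pullback, and cancels. -/
theorem mulInvariantVectorField_chart (X : GroupLieAlgebra 𝓘(ℝ, E) G) :
    (mpullbackWithin 𝓘(ℝ, E) 𝓘(ℝ, E) (extChartAt 𝓘(ℝ, E) (1 : G)).symm
        (mulInvariantVectorField X) Set.univ : E → E) =ᶠ[𝓝 (chartOne E G)]
      fun a => fderiv ℝ (chartMul E G) (a, chartOne E G) ((0 : E), (X : E)) := by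
  have hc : ∀ᶠ p in 𝓝 (chartOne E G, chartOne E G), DifferentiableAt ℝ (chartMul E G) p :=
    (((contDiffAt_chartMul E G).of_le (m := 1) (by simp)).eventually (by simp)).mono fun p hp =>
      hp.differentiableAt (by norm_num)
  have ht : Tendsto (fun a : E => (a, chartOne E G)) (𝓝 (chartOne E G))
      (𝓝 (chartOne E G, chartOne E G)) :=
    continuousAt_id.prodMk continuousAt_const
  have hman : IsManifold 𝓘(ℝ, E) ∞ G := ContMDiffMul.toIsManifold
  have hman1 : IsManifold 𝓘(ℝ, E) 1 G := IsManifold.of_le (n := ∞) (by simp)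
  have htg : IsTopologicalGroup G := topologicalGroup_of_lieGroup 𝓘(ℝ, E) ∞
  have hct : Tendsto (extChartAt 𝓘(ℝ, E) (1 : G)).symm (𝓝 (chartOne E G)) (𝓝 1) := by
    have := (contMDiffAt_chartSymm E G).continuousAt.tendsto
    rwa [chartSymm_one] at this
  filter_upwards [ht.eventually hc, eventually_mem_chartTarget E G, chartMul_one E G]
    with a h1 h2 h3
  have hinv := isInvertible_mfderivWithin_extChartAt_symm (I := 𝓘(ℝ, E)) h2
  have hd := mdifferentiableWithinAt_extChartAt_symm (I := 𝓘(ℝ, E)) h2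
  simp only [modelWithCornersSelf_coe, Set.range_id] at hinv hd
  refine hinv.inverse_apply_eq.2 ?_
  rw [mfderivWithin_univ]
  rw [mdifferentiableWithinAt_univ] at hd
  set g := (extChartAt 𝓘(ℝ, E) (1 : G)).symm a with hg
  have e1 := mfderiv_eq_fderiv hd hg.symm
    (fderiv ℝ (chartMul E G) (a, chartOne E G) ((0 : E), (X : E)))
  have e2 := mfderiv_eq_fderiv (mdifferentiableAt_mul_left (E := E) g 1) (mul_one g) X
  have hψ : DifferentiableAt ℝ
      (fun u => extChartAt 𝓘(ℝ, E) g ((extChartAt 𝓘(ℝ, E) (1 : G)).symm u)) a :=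
    mdifferentiableAt_iff_differentiableAt.1
      (MDifferentiableAt.comp (g := extChartAt 𝓘(ℝ, E) g) a
        (mdifferentiableAt_extChartAt (mem_chart_source E g)) hd)
  have hgs : g ∈ (extChartAt 𝓘(ℝ, E) (1 : G)).source :=
    (extChartAt 𝓘(ℝ, E) (1 : G)).map_target h2
  have hev : ∀ᶠ u in 𝓝 (chartOne E G),
      g * (extChartAt 𝓘(ℝ, E) (1 : G)).symm u ∈ (extChartAt 𝓘(ℝ, E) (1 : G)).source := by
    have h5 : Tendsto (fun u => g * (extChartAt 𝓘(ℝ, E) (1 : G)).symm u) (𝓝 (chartOne E G))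
        (𝓝 g) := by simpa using hct.const_mul g
    exact h5.eventually_mem ((isOpen_extChartAt_source (1 : G)).mem_nhds hgs)
  have e3 := hasFDerivAt_partial h1
  have hψ' : HasFDerivAt (fun u => extChartAt 𝓘(ℝ, E) g ((extChartAt 𝓘(ℝ, E) (1 : G)).symm u))
      (fderiv ℝ (fun u => extChartAt 𝓘(ℝ, E) g ((extChartAt 𝓘(ℝ, E) (1 : G)).symm u)) a)
      (chartMul E G (a, chartOne E G)) := by
    rw [h3]; exact hψ.hasFDerivAt
  have e4 := (HasFDerivAt.comp (chartOne E G) hψ' e3).congr_of_eventuallyEq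
    (f₁ := fun u => extChartAt 𝓘(ℝ, E) g (g * (extChartAt 𝓘(ℝ, E) (1 : G)).symm u))
    (hev.mono fun u hu => by
      simp only [Function.comp, chartMul, ← hg]
      rw [(extChartAt 𝓘(ℝ, E) (1 : G)).left_inv hu])
  exact (e2.trans (DFunLike.congr_fun e4.fderiv X)).trans e1.symm

/-- The differential of the adjoint representation at the unit is the Lie bracket. -/
theorem hasMFDerivAt_Ad (X : GroupLieAlgebra 𝓘(ℝ, E) G) :
    ∃ A : E →L[ℝ] E, HasMFDerivAt 𝓘(ℝ, E) 𝓘(ℝ, E) (M' := E) (fun g : G => Ad (E := E) g X) 1 A ∧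
      ∀ Z : GroupLieAlgebra 𝓘(ℝ, E) G, A Z = ⁅Z, X⁆ := by
  obtain ⟨h1, h2⟩ := fderiv_localAd ((contDiffAt_chartMul E G).of_le (m := 2) (ENat.LEInfty.out))
    ((contDiffAt_chartConj E G).of_le (m := 2) (ENat.LEInfty.out)) (chartMul_one E G)
    (Eventually.of_forall (chartConj_one E G)) (chartConj_one_left E G)
    (eventually_chartMul_chartConj E G) X
  refine ⟨_, ((hasMFDerivAt_iff_hasFDerivAt.2 h1.hasFDerivAt).comp (1 : G)
    (f := extChartAt 𝓘(ℝ, E) (1 : G))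
    (mdifferentiableAt_extChartAt (mem_chart_source E (1 : G))).hasMFDerivAt).congr_of_eventuallyEq
      (Ad_eventuallyEq (E := E) X), fun Z => ?_⟩
  have h3 : ∀ w : E, (mfderiv 𝓘(ℝ, E) 𝓘(ℝ, E) (extChartAt 𝓘(ℝ, E) (1 : G)) 1 w : E) = w :=
    fun w => by rw [mfderiv_extChartAt_self]; rfl
  have hman : IsManifold 𝓘(ℝ, E) ∞ G := ContMDiffMul.toIsManifold
  have hman1 : IsManifold 𝓘(ℝ, E) 1 G := IsManifold.of_le (n := ∞) (by simp)
  have h4 := mlieBracket_eq_lieBracket (mulInvariantVectorField Z) (mulInvariantVectorField X) (1 : G)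
  have hX := mulInvariantVectorField_chart (G := G) X
  have hZ := mulInvariantVectorField_chart (G := G) Z
  have h5 := Filter.EventuallyEq.lieBracket_vectorField_eq (E := E) (𝕜 := ℝ) hZ hX
  refine Eq.trans ?_ ((h2 Z).trans (Eq.trans ?_ (h4.trans h5).symm))
  · exact congrArg _ (h3 Z)
  -- The bracket of the coordinate fields also involves their values at the unit, which are `Z` and
  -- `X` themselves.
  · have h6 : ∀ w : E, fderiv ℝ (chartMul E G) (chartOne E G, chartOne E G) ((0 : E), w) = w :=
      fun w => by
        have e1 := hasFDerivAt_partial (((contDiffAt_chartMul E G).of_le (m := 1)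
          ENat.LEInfty.out).differentiableAt (by norm_num))
        have e2 := e1.unique ((hasFDerivAt_id (chartOne E G)).congr_of_eventuallyEq
          (chartMul_one_left E G))
        simpa using DFunLike.congr_fun e2 w
    change _ = fderiv ℝ _ (chartOne E G) _ - fderiv ℝ _ (chartOne E G) _
    exact congrArg₂ (· - ·) (congrArg _ (h6 Z).symm) (congrArg _ (h6 X).symm)

end LieGroupChart

end SympDirac
end

noncomputable section

namespace SympDirac

open Filter Topology VectorField

/-! ### Functions with vanishing differential -/

section LocallyConstant

variable {F : Type*} [NormedAddCommGroup F] [NormedSpace ℝ F]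
  {M : Type*} [TopologicalSpace M] [ChartedSpace F M]
  {E : Type*} [NormedAddCommGroup E] [NormedSpace ℝ E]

/-- The chart of a vector space is the identity, so only the source has to be read in coordinates.
This makes the product rules of ordinary calculus available. -/
theorem hasMFDerivAt_vector_iff {f : M → E} {x : M} {A : F →L[ℝ] E} :
    HasMFDerivAt 𝓘(ℝ, F) 𝓘(ℝ, E) f x A ↔ ContinuousAt f x ∧
      HasFDerivAt (fun u => f ((extChartAt 𝓘(ℝ, F) x).symm u)) A (extChartAt 𝓘(ℝ, F) x x) := by
  have h : ∀ (φ : F → E) (p : F),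
      HasFDerivWithinAt φ A (Set.range 𝓘(ℝ, F)) p ↔ HasFDerivAt φ A p := fun φ p => by
    rw [modelWithCornersSelf_coe, Set.range_id, hasFDerivWithinAt_univ]
  exact and_congr Iff.rfl (h _ _)

/-- A function with vanishing differential is locally constant. -/
theorem isLocallyConstant_of_hasMFDerivAt_zero [IsManifold 𝓘(ℝ, F) 1 M] {f : M → E}
    (hf : ∀ x, HasMFDerivAt 𝓘(ℝ, F) 𝓘(ℝ, E) f x (0 : F →L[ℝ] E)) : IsLocallyConstant f := by
  rw [IsLocallyConstant.iff_eventually_eq]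
  intro x
  have hopen := isOpen_extChartAt_target (I := 𝓘(ℝ, F)) x
  obtain ⟨r, hr, hb⟩ := Metric.isOpen_iff.1 hopen _ (mem_extChartAt_target (I := 𝓘(ℝ, F)) x)
  have hd : ∀ u ∈ Metric.ball (extChartAt 𝓘(ℝ, F) x x) r,
      HasFDerivAt (fun u => f ((extChartAt 𝓘(ℝ, F) x).symm u)) (0 : F →L[ℝ] E) u := by
    intro u hu
    have h1 := mdifferentiableWithinAt_extChartAt_symm (I := 𝓘(ℝ, F)) (hb hu)
    rw [modelWithCornersSelf_coe, Set.range_id, mdifferentiableWithinAt_univ] at h1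
    have h2 := (hf ((extChartAt 𝓘(ℝ, F) x).symm u)).comp u h1.hasMFDerivAt
    have h3 : (0 : F →L[ℝ] E).comp (mfderiv 𝓘(ℝ, F) 𝓘(ℝ, F) (extChartAt 𝓘(ℝ, F) x).symm u) = 0 :=
      ContinuousLinearMap.zero_comp _
    exact (congrArg (fun A : F →L[ℝ] E =>
      HasFDerivAt (fun u => f ((extChartAt 𝓘(ℝ, F) x).symm u)) A u) h3).mp
        (hasMFDerivAt_iff_hasFDerivAt.1 h2)
  have hc : ContinuousAt (extChartAt 𝓘(ℝ, F) x) x := continuousAt_extChartAt x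
  filter_upwards [hc.eventually_mem (Metric.ball_mem_nhds _ hr),
    extChartAt_source_mem_nhds (I := 𝓘(ℝ, F)) x] with y hy hys
  have h4 := Metric.isOpen_ball.is_const_of_fderiv_eq_zero (𝕜 := ℝ)
    (convex_ball _ r).isPreconnected
    (fun u hu => (hd u hu).differentiableAt.differentiableWithinAt)
    (fun u hu => (hd u hu).fderiv) hy (Metric.mem_ball_self hr)
  simpa only [(extChartAt 𝓘(ℝ, F) x).left_inv hys, extChartAt_to_inv] using h4

end LocallyConstant

/-! ### Invariance of the inner product under the isotropy representation -/

section Isotropy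

variable {E : Type*} [NormedAddCommGroup E] [NormedSpace ℝ E]
  {G : Type*} [TopologicalSpace G] [ChartedSpace E G] [Group G] [LieGroup 𝓘(ℝ, E) ∞ G]
  {F : Type*} [NormedAddCommGroup F] [NormedSpace ℝ F]
  {H : Subgroup G} [ChartedSpace F H] [LieGroup 𝓘(ℝ, F) ∞ H]

omit [LieGroup 𝓘(ℝ, F) ∞ H] in
/-- The differential at the unit of the restriction of the adjoint representation to a Lie
subgroup. -/
theorem hasMFDerivAt_Ad_subgroup
    (hH : ContMDiff 𝓘(ℝ, F) 𝓘(ℝ, E) ∞ (Subtype.val : H → G)) (X : GroupLieAlgebra 𝓘(ℝ, E) G) :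
    ∃ A : F →L[ℝ] E,
      HasMFDerivAt 𝓘(ℝ, F) 𝓘(ℝ, E) (M' := E) (fun h : H => Ad (E := E) (h : G) X) 1 A ∧
      ∀ (z : F) (Z : GroupLieAlgebra 𝓘(ℝ, E) G), subgroupDiff E F H z = Z → A z = ⁅Z, X⁆ := by
  obtain ⟨A, h1, h2⟩ := hasMFDerivAt_Ad (E := E) X
  have h3 : HasMFDerivAt 𝓘(ℝ, F) 𝓘(ℝ, E) (Subtype.val : H → G) 1 (subgroupDiff E F H) :=
    (hH.mdifferentiable (by simp) 1).hasMFDerivAt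
  refine ⟨A.comp (subgroupDiff E F H), HasMFDerivAt.comp (M' := G) (M'' := E) (g := fun g : G => Ad (E := E) g X)
    (1 : H) h1 h3, fun z Z hZ => hZ ▸ h2 _⟩

variable {n : ℕ} {S : HermitianSymmetricData E F H n}

/-- The isotropy representation of `H` on `𝔪`. -/
def isotropy (κ : S.Lift) : H →* (S.m ≃ₗ[ℝ] S.m) := S.rho.comp κ.toHom

omit [LieGroup 𝓘(ℝ, E) ∞ G] [LieGroup 𝓘(ℝ, F) ∞ H] in
theorem coe_isotropy (κ : S.Lift) (h : H) (Y : S.m) :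
    (isotropy κ h Y : GroupLieAlgebra 𝓘(ℝ, E) G) = Ad (E := E) (h : G) Y :=
  κ.rho_toHom h Y

omit [LieGroup 𝓘(ℝ, E) ∞ G] [LieGroup 𝓘(ℝ, F) ∞ H] in
-- `Mp` is the commutator subgroup of `Mpᶜ`, hence contained in it. This inclusion supplies both the
-- symplectic property of the isotropy and its relation with the Weyl operators.
theorem Lift.mem_Mpc (κ : S.Lift) (h : H) : (isotropy κ h, κ.lam h) ∈ S.Mpc :=
  (Subgroup.commutator_le.2 fun _ h₁ _ h₂ => mul_mem (mul_mem (mul_mem h₁ h₂) (inv_mem h₁))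
    (inv_mem h₂) : S.Mp ≤ S.Mpc) (κ.toHom h).2

omit [LieGroup 𝓘(ℝ, E) ∞ G] [LieGroup 𝓘(ℝ, F) ∞ H] in
theorem ω₀_isotropy (κ : S.Lift) (h : H) (Y Z : S.m) :
    S.ω₀ (isotropy κ h Y) (isotropy κ h Z) = S.ω₀ Y Z :=
  (Lift.mem_Mpc κ h).1 Y Z

omit [LieGroup 𝓘(ℝ, E) ∞ G] [LieGroup 𝓘(ℝ, F) ∞ H] in
-- Since `J₀` commutes with `ad(𝔥)`, this is the invariance of `ω₀` evaluated at `X` and `J₀ Y`.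
theorem g₀_ad_invariant (Z : GroupLieAlgebra 𝓘(ℝ, E) G) (hZ : Z ∈ subgroupLieAlgebra E F H)
    (X Y : S.m) :
    S.g₀ ⟨⁅Z, (X : GroupLieAlgebra 𝓘(ℝ, E) G)⁆, S.bracket_h_m Z hZ X X.2⟩ Y
      + S.g₀ X ⟨⁅Z, (Y : GroupLieAlgebra 𝓘(ℝ, E) G)⁆, S.bracket_h_m Z hZ Y Y.2⟩ = 0 := by
  simp only [HermitianSymmetricData.g₀, LinearMap.compl₂_apply]
  rw [S.J₀_ad_invariant Z hZ]
  exact S.ω₀_ad_invariant Z hZ X (S.J₀ Y)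

/-- The extension of the inner product `g₀` to the Lie algebra of `G` for which `𝔥` is the
radical. -/
def g₀Ext [FiniteDimensional ℝ E] (S : HermitianSymmetricData E F H n) : E →L[ℝ] E →L[ℝ] ℝ :=
  LinearMap.toContinuousBilinearMap (𝕜 := ℝ) (E := E) (F := E)
    (S.g₀.compl₁₂ (S.m.projectionOnto _ S.isCompl.symm)
      (S.m.projectionOnto _ S.isCompl.symm))

omit [LieGroup 𝓘(ℝ, E) ∞ G] [LieGroup 𝓘(ℝ, F) ∞ H] in
theorem g₀Ext_apply [FiniteDimensional ℝ E] (X Y : S.m) : g₀Ext S X.1 Y.1 = S.g₀ X Y := by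
  have h : ∀ X : S.m, S.m.projectionOnto _ S.isCompl.symm X.1 = X := fun X =>
    Submodule.projectionOnto_apply_left S.isCompl.symm X
  change S.g₀ (S.m.projectionOnto _ S.isCompl.symm X.1) (S.m.projectionOnto _ S.isCompl.symm Y.1) = _
  rw [h, h]

/-- As a function of `h`, the left side has zero differential at the unit by infinitesimal
invariance, hence everywhere by right translation. It is then constant because `H` is connected. -/
theorem g₀_isotropy [FiniteDimensional ℝ E]
    (hH : ContMDiff 𝓘(ℝ, F) 𝓘(ℝ, E) ∞ (Subtype.val : H → G)) (hc : IsConnected (H : Set G))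
    (κ : S.Lift) (h : H) (X Y : S.m) :
    S.g₀ (isotropy κ h X) (isotropy κ h Y) = S.g₀ X Y := by
  have h1 : ∀ X Y : S.m, HasMFDerivAt 𝓘(ℝ, F) 𝓘(ℝ, ℝ)
      (fun h : H => S.g₀ (isotropy κ h X) (isotropy κ h Y)) 1 (0 : F →L[ℝ] ℝ) := by
    intro X Y
    obtain ⟨A, hA, hA'⟩ := hasMFDerivAt_Ad_subgroup hH (X : GroupLieAlgebra 𝓘(ℝ, E) G)
    obtain ⟨B, hB, hB'⟩ := hasMFDerivAt_Ad_subgroup hH (Y : GroupLieAlgebra 𝓘(ℝ, E) G)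
    obtain ⟨hA1, hA2⟩ := hasMFDerivAt_vector_iff (E := E).1 hA
    obtain ⟨hB1, hB2⟩ := hasMFDerivAt_vector_iff (E := E).1 hB
    -- `Ad(h)X` is differentiated as a curve in the ambient Lie algebra, so the form is extended
    -- from `𝔪` before the product rule is applied.
    have hq : (fun h : H => S.g₀ (isotropy κ h X) (isotropy κ h Y)) = fun h : H =>
        g₀Ext S (Ad (E := E) (h : G) X.1) (Ad (E := E) (h : G) Y.1) := by
      funext h
      rw [← g₀Ext_apply, coe_isotropy, coe_isotropy]
    rw [hq, hasMFDerivAt_vector_iff]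
    refine ⟨((g₀Ext S).continuous.continuousAt.comp hA1).clm_apply hB1, ?_⟩
    have h3 := (g₀Ext S).hasFDerivAt_of_bilinear hA2 hB2
    refine h3.congr_fderiv ?_
    ext z
    obtain ⟨Z, hZ⟩ : ∃ Z : GroupLieAlgebra 𝓘(ℝ, E) G, subgroupDiff E F H z = Z := ⟨_, rfl⟩
    have e1 : ∀ Y : S.m, Ad (E := E)
        ((((extChartAt 𝓘(ℝ, F) (1 : H)).symm (extChartAt 𝓘(ℝ, F) (1 : H) 1) : H) : G)) Y.1 = Y.1 :=
      fun Y => by rw [extChartAt_to_inv, ← coe_isotropy κ, map_one]; rfl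
    have e2 := g₀_ad_invariant (S := S) Z ⟨z, hZ⟩ X Y
    rw [← g₀Ext_apply, ← g₀Ext_apply] at e2
    have e3 : g₀Ext S (Ad (E := E)
        ((((extChartAt 𝓘(ℝ, F) (1 : H)).symm (extChartAt 𝓘(ℝ, F) (1 : H) 1) : H) : G)) X.1) (B z)
        + g₀Ext S (A z) (Ad (E := E)
        ((((extChartAt 𝓘(ℝ, F) (1 : H)).symm (extChartAt 𝓘(ℝ, F) (1 : H) 1) : H) : G)) Y.1) = 0 := by
      rw [e1 X, e1 Y, hA' z Z hZ, hB' z Z hZ, add_comm]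
      exact e2
    exact e3
  have h2 : ∀ (X Y : S.m) (k : H), HasMFDerivAt 𝓘(ℝ, F) 𝓘(ℝ, ℝ)
      (fun h : H => S.g₀ (isotropy κ h X) (isotropy κ h Y)) k (0 : F →L[ℝ] ℝ) := by
    intro X Y k
    -- Writing `κ(h) = κ(hk⁻¹)κ(k)` moves the point `k` to the unit, at the cost of replacing `X`
    -- and `Y` by `κ(k)X` and `κ(k)Y`.
    have h3 : MDifferentiableAt 𝓘(ℝ, F) 𝓘(ℝ, F) (fun x : H => x * k⁻¹) k :=
      (contMDiff_mul_right (I := 𝓘(ℝ, F)) (n := ∞) (a := k⁻¹)).mdifferentiable (by simp) k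
    have h4 := h1 (isotropy κ k X) (isotropy κ k Y)
    rw [← mul_inv_cancel k] at h4
    have h5 := HasMFDerivAt.comp (M' := H) k h4 h3.hasMFDerivAt
    have h6 : (fun h : H => S.g₀ (isotropy κ h X) (isotropy κ h Y)) =
        (fun h : H => S.g₀ (isotropy κ h (isotropy κ k X)) (isotropy κ h (isotropy κ k Y))) ∘
          fun x : H => x * k⁻¹ := by
      funext h
      simp only [Function.comp, ← LinearEquiv.mul_apply, ← map_mul, inv_mul_cancel_right]
    rw [h6]
    exact (congrArg (fun A : F →L[ℝ] ℝ => HasMFDerivAt 𝓘(ℝ, F) 𝓘(ℝ, ℝ) ((fun h : H =>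
      S.g₀ (isotropy κ h (isotropy κ k X)) (isotropy κ h (isotropy κ k Y))) ∘
          fun x : H => x * k⁻¹) k A) (ContinuousLinearMap.zero_comp _)).mp h5
  have hman : IsManifold 𝓘(ℝ, F) ∞ H := ContMDiffMul.toIsManifold
  have hman1 : IsManifold 𝓘(ℝ, F) 1 H := IsManifold.of_le (n := ∞) (by simp)
  have : PreconnectedSpace H := Subtype.preconnectedSpace hc.isPreconnected
  have h4 := (isLocallyConstant_of_hasMFDerivAt_zero (h2 X Y)).apply_eq_of_preconnectedSpace h 1
  simpa using h4

end Isotropy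

end SympDirac
end

noncomputable section

namespace SympDirac

open Filter Topology MeasureTheory

/-! ### Schrödinger operators and their generators -/

section Weyl

variable {n : ℕ}

/-- The operator `Σ_j (a_j · i x_j + b_j · ∂/∂x_j)` on the Schwartz space. -/
def schrodinger (a b : Fin n → ℝ) : Schw n →ₗ[ℂ] Schw n :=
  ∑ j, a j • cliffordBasis n (Sum.inl j) + ∑ j, b j • cliffordBasis n (Sum.inr j)

theorem schrodinger_apply (a b : Fin n → ℝ) (f : Schw n) (x : Fin n → ℝ) :
    schrodinger a b f x = Complex.I * ((a ⬝ᵥ x : ℝ) : ℂ) * f x + fderiv ℝ f x b := by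
  have h1 : fderiv ℝ f x b = ∑ j, b j • lineDeriv ℝ f x (Pi.single j 1) := by
    conv_lhs => rw [pi_eq_sum_univ' b]
    simp only [map_sum, map_smul]
    refine Finset.sum_congr rfl fun j _ => ?_
    rw [f.differentiableAt.lineDeriv_eq_fderiv]
  rw [h1]
  simp only [schrodinger, LinearMap.add_apply, LinearMap.sum_apply, LinearMap.smul_apply,
    _root_.add_apply, _root_.sum_apply, _root_.smul_apply, cliffordBasis_inl_apply,
    cliffordBasis_inr_apply]
  congr 1
  simp only [dotProduct, Complex.ofReal_sum, Finset.mul_sum, Finset.sum_mul]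
  refine Finset.sum_congr rfl fun j _ => ?_
  rw [Complex.real_smul]
  push_cast
  ring

/-- The quadratic phase `t²(a·b)/2` makes the phase derivative `a·(x + tb)`, which is the multiplier
of the generator at the shifted point. Hence the derivative at every `t` is the same Weyl operator
applied to `schrodinger a b f`. -/
theorem hasDerivAt_weylFun (a b : Fin n → ℝ) (f : Schw n) (x : Fin n → ℝ) (t : ℝ) :
    HasDerivAt (fun t : ℝ => weylFun (t • a) (t • b) f x)
      (weylFun (t • a) (t • b) (schrodinger a b f) x) t := by
  have h1 : HasDerivAt (fun t : ℝ => (t • a) ⬝ᵥ x + ((t • a) ⬝ᵥ (t • b)) / 2)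
      (a ⬝ᵥ (x + t • b)) t := by
    simp only [smul_dotProduct, dotProduct_smul, smul_eq_mul, dotProduct_add]
    convert! (((hasDerivAt_id t).mul_const (a ⬝ᵥ x)).add
      (((hasDerivAt_id t).mul ((hasDerivAt_id t).mul_const (a ⬝ᵥ b))).div_const 2)) using 1
    simp
  have h2 : HasDerivAt (fun t : ℝ => x + t • b) b t := by
    simpa using ((hasDerivAt_id t).smul_const b).const_add x
  have h3 : HasDerivAt (fun t : ℝ => f (x + t • b)) (fderiv ℝ f (x + t • b) b) t :=
    f.differentiableAt.hasFDerivAt.comp_hasDerivAt t h2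
  have h4 := ((h1.ofReal_comp.const_mul Complex.I).cexp).mul h3
  refine h4.congr_deriv ?_
  rw [weylFun, schrodinger_apply]
  ring

theorem norm_weylFun (a b : Fin n → ℝ) (f : (Fin n → ℝ) → ℂ) (x : Fin n → ℝ) :
    ‖weylFun a b f x‖ = ‖f (x + b)‖ := by
  rw [weylFun, norm_mul, mul_comm Complex.I, Complex.norm_exp_ofReal_mul_I, one_mul]

theorem weylFun_ae_congr (a b : Fin n → ℝ) {f g : (Fin n → ℝ) → ℂ} (h : f =ᵐ[volume] g) :
    weylFun a b f =ᵐ[volume] weylFun a b g := by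
  have h1 := (measurePreserving_add_right (volume : Measure (Fin n → ℝ)) b).quasiMeasurePreserving.ae h
  filter_upwards [h1] with x hx
  rw [weylFun, weylFun, hx]

theorem coe_weyl_incl (a b : Fin n → ℝ) (f : Schw n) :
    (weyl a b (incl n f) : (Fin n → ℝ) → ℂ) =ᵐ[volume] weylFun a b f :=
  (MemLp.coeFn_toLp _).trans (weylFun_ae_congr a b (f.coeFn_toLp 2 volume))

theorem weyl_zero (f : L2 n) : weyl 0 0 f = f := by
  refine Lp.ext ((MemLp.coeFn_toLp _).trans (Eventually.of_forall fun x => ?_))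
  simp [weylFun]

theorem continuous_weylFun (a b : Fin n → ℝ) (f : Schw n) : Continuous (weylFun a b f) := by
  have := f.continuous
  unfold weylFun dotProduct
  fun_prop

theorem schwartz_bound (f : Schw n) (N : ℕ) :
    ∃ C, 0 ≤ C ∧ ∀ x, ‖f x‖ ≤ C * ((1 + ‖x‖) ^ N)⁻¹ := by
  refine ⟨2 ^ N * ((Finset.Iic (N, 0)).sup fun m => SchwartzMap.seminorm ℝ m.1 m.2) f,
    mul_nonneg (by positivity) (apply_nonneg _ _), fun x => ?_⟩
  · have h := SchwartzMap.one_add_le_sup_seminorm_apply (𝕜 := ℝ) (m := (N, 0)) le_rfl le_rfl f x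
    rw [norm_iteratedFDeriv_zero, mul_comm] at h
    exact (le_mul_inv_iff₀ (by positivity)).2 h

/-- The square decays with exponent `2(n+1) > n`, so it is integrable on `ℝⁿ`. This provides the
dominating function for Schwartz decay of order `n + 1`. -/
theorem memLp_one_add_norm :
    MemLp (fun x : Fin n → ℝ => ((1 + ‖x‖) ^ (n + 1))⁻¹) 2 volume := by
  have hc : Continuous fun x : Fin n → ℝ => ((1 + ‖x‖) ^ (n + 1))⁻¹ :=
    Continuous.inv₀ (by fun_prop) fun x => by positivity
  rw [memLp_two_iff_integrable_sq hc.aestronglyMeasurable]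
  have h := integrable_one_add_norm (E := Fin n → ℝ) (μ := volume) (r := ((2 * (n + 1) : ℕ) : ℝ))
    (by simp; linarith)
  refine h.congr (Eventually.of_forall fun x => ?_)
  simp only
  rw [Real.rpow_neg (by positivity), Real.rpow_natCast, inv_pow, ← pow_mul, mul_comm 2]

/-- The infinitesimal generator of the Schrödinger operators, in the weak sense. -/
theorem hasDerivAt_inner_weyl (a b : Fin n → ℝ) (f : Schw n) (k : L2 n) :
    HasDerivAt (fun t : ℝ => inner ℂ k (weyl (t • a) (t • b) (incl n f)))
      (inner ℂ k (incl n (schrodinger a b f))) 0 := by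
  obtain ⟨C, hC, hCb⟩ := schwartz_bound (schrodinger a b f) (n + 1)
  have hk := Lp.aestronglyMeasurable k
  have hF : ∀ (t : ℝ) (f : Schw n), (fun x => inner ℂ (k x) (weyl (t • a) (t • b) (incl n f) x))
      =ᵐ[volume] fun x => inner ℂ (k x) (weylFun (t • a) (t • b) f x) := fun t f => by
    filter_upwards [coe_weyl_incl (t • a) (t • b) f] with x hx
    rw [hx]
  have hm : ∀ (t : ℝ) (f : Schw n),
      AEStronglyMeasurable (fun x => inner ℂ (k x) (weylFun (t • a) (t • b) f x)) volume :=
    fun t f => hk.inner (continuous_weylFun _ _ f).aestronglyMeasurable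
  have key := hasDerivAt_integral_of_dominated_loc_of_deriv_le (μ := volume) (𝕜 := ℝ)
    (F := fun t x => inner ℂ (k x) (weylFun (t • a) (t • b) f x))
    (F' := fun t x => inner ℂ (k x) (weylFun (t • a) (t • b) (schrodinger a b f) x))
    (bound := fun x => ‖k x‖ * ((C * (1 + ‖b‖) ^ (n + 1)) * ((1 + ‖x‖) ^ (n + 1))⁻¹))
    (x₀ := (0 : ℝ)) (s := Metric.ball 0 1) (Metric.ball_mem_nhds _ one_pos)
    (Eventually.of_forall fun t => hm t f)
    ((L2.integrable_inner k _).congr (hF 0 f)) (hm 0 _)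
    (Eventually.of_forall fun x t ht => ?_) ?_ (Eventually.of_forall fun x t ht => ?_)
  · have h1 := key.2
    have h2 : ∀ t : ℝ, ∫ x, inner ℂ (k x) (weylFun (t • a) (t • b) f x) =
        inner ℂ k (weyl (t • a) (t • b) (incl n f)) := fun t =>
      (integral_congr_ae (hF t f)).symm
    have h3 : ∫ x, inner ℂ (k x) (weylFun ((0 : ℝ) • a) ((0 : ℝ) • b) (schrodinger a b f) x) =
        inner ℂ k (incl n (schrodinger a b f)) := by
      rw [← integral_congr_ae (hF 0 _), zero_smul, zero_smul, weyl_zero]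
      rfl
    simpa only [h2, h3] using h1
  · refine (norm_inner_le_norm _ _).trans (mul_le_mul_of_nonneg_left ?_ (norm_nonneg _))
    rw [norm_weylFun]
    refine (hCb _).trans ?_
    rw [mul_assoc]
    refine mul_le_mul_of_nonneg_left ?_ hC
    -- The claim reduces to `1 + ‖x‖ ≤ (1 + ‖b‖)(1 + ‖x + tb‖)` for `|t| < 1`, which makes the bound
    -- uniform in `t`.
    rw [← div_eq_mul_inv, inv_le_comm₀ (by positivity) (by positivity), inv_div,
      div_le_iff₀ (by positivity), ← mul_pow]
    refine pow_le_pow_left₀ (by positivity) ?_ _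
    have h1 : ‖t • b‖ ≤ ‖b‖ := by
      rw [norm_smul]
      exact mul_le_of_le_one_left (norm_nonneg _) (mem_ball_zero_iff.1 ht).le
    have h2 : ‖x‖ ≤ ‖x + t • b‖ + ‖t • b‖ := by
      simpa using norm_sub_le (x + t • b) (t • b)
    nlinarith [norm_nonneg b, norm_nonneg (x + t • b)]
  · exact (Lp.memLp k).norm.integrable_mul (memLp_one_add_norm.const_mul _)
  · exact ((innerSL ℂ (k x)).restrictScalars ℝ).hasFDerivAt.comp_hasDerivAt t
      (hasDerivAt_weylFun a b f x t)

end Weyl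

/-! ### Equivariance of Clifford multiplication -/

section Lift

variable {E : Type*} [NormedAddCommGroup E] [NormedSpace ℝ E]
  {G : Type*} [TopologicalSpace G] [ChartedSpace E G] [Group G]
  {F : Type*} [NormedAddCommGroup F] [NormedSpace ℝ F]
  {H : Subgroup G} [ChartedSpace F H] {n : ℕ} {S : HermitianSymmetricData E F H n}

theorem clifford_eq_schrodinger (Y : S.m) :
    S.clifford Y = schrodinger (fun j => S.X.repr Y (Sum.inl j)) fun j => S.X.repr Y (Sum.inr j) := by
  rw [clifford, Module.Basis.constr_apply_fintype, Fintype.sum_sum_type]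
  rfl

/-- Clifford multiplication is equivariant under the metaplectic representation. -/
theorem lam_clifford (κ : S.Lift) (h : H) (Y : S.m) {f f' : Schw n}
    (hf : κ.lam h (incl n f) = incl n f') :
    κ.lam h (incl n (S.clifford Y f)) = incl n (S.clifford (isotropy κ h Y) f') := by
  -- The generator is known only in the weak sense. Testing against `k` and moving the unitary
  -- `λ(h)` across the inner product, both sides become derivatives at `0` of the same function of
  -- `t`.
  refine ext_inner_left ℂ fun k => ?_
  have h1 := hasDerivAt_inner_weyl (fun j => S.X.repr Y (Sum.inl j))
    (fun j => S.X.repr Y (Sum.inr j)) f ((κ.lam h).symm k)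
  have h2 := hasDerivAt_inner_weyl (fun j => S.X.repr (isotropy κ h Y) (Sum.inl j))
    (fun j => S.X.repr (isotropy κ h Y) (Sum.inr j)) f' k
  rw [← clifford_eq_schrodinger] at h1 h2
  have e : ∀ g, inner ℂ ((κ.lam h).symm k) g = inner ℂ k (κ.lam h g) := fun g => by
    rw [← (κ.lam h).inner_map_map, (κ.lam h).apply_symm_apply]
  rw [e] at h1
  refine h1.unique ?_
  convert! h2 using 2
  rename_i t
  have h3 := (Lift.mem_Mpc κ h).2 (t • Y) (incl n f)
  simp only [weylOp, map_smul, hf] at h3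
  rw [e]
  exact congrArg (inner ℂ k) h3

end Lift

end SympDirac
end

noncomputable section

namespace SympDirac

/-! ### Creation and annihilation operators on Hermite functions -/

section Hermite

theorem hasDerivAt_iteratedDeriv_gaussian (k : ℕ) (t : ℝ) :
    HasDerivAt (iteratedDeriv k fun s : ℝ => Real.exp (-s ^ 2))
      (iteratedDeriv (k + 1) (fun s : ℝ => Real.exp (-s ^ 2)) t) t := by
  have hc : ContDiff ℝ ∞ fun s : ℝ => Real.exp (-s ^ 2) := by fun_prop
  rw [iteratedDeriv_succ]
  exact (hc.differentiable_iteratedDeriv k (by exact_mod_cast WithTop.coe_lt_top _) t).hasDerivAt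

/-- This is `g' = -2tg` for the Gaussian `g`, differentiated `k` times. At `k = 0` the truncated
index `k - 1` is harmless, as its coefficient vanishes. -/
theorem iteratedDeriv_gaussian_succ (k : ℕ) (t : ℝ) :
    iteratedDeriv (k + 1) (fun s : ℝ => Real.exp (-s ^ 2)) t =
      -2 * t * iteratedDeriv k (fun s : ℝ => Real.exp (-s ^ 2)) t
        - 2 * k * iteratedDeriv (k - 1) (fun s : ℝ => Real.exp (-s ^ 2)) t := by
  induction k generalizing t with
  | zero =>
    have h : HasDerivAt (fun s : ℝ => Real.exp (-s ^ 2)) (Real.exp (-t ^ 2) * (-(2 * t))) t := by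
      simpa using ((hasDerivAt_pow 2 t).neg).exp
    simp [iteratedDeriv_one, h.deriv]
    ring
  | succ k ih =>
    have h1 := hasDerivAt_iteratedDeriv_gaussian (k + 1) t
    have h2 := hasDerivAt_iteratedDeriv_gaussian k t
    have h3 : k = 0 ∨ k - 1 + 1 = k := by omega
    have h4 : HasDerivAt (fun t => (k : ℝ) * iteratedDeriv (k - 1) (fun s : ℝ => Real.exp (-s ^ 2)) t)
        (k * iteratedDeriv k (fun s : ℝ => Real.exp (-s ^ 2)) t) t := by
      rcases h3 with rfl | h3
      · simpa using hasDerivAt_const t (0 : ℝ)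
      · have := (hasDerivAt_iteratedDeriv_gaussian (k - 1) t).const_mul (k : ℝ)
        rwa [h3] at this
    have h5 := (((hasDerivAt_id t).const_mul (-2)).mul h2).sub (h4.const_mul 2)
    have h6 : iteratedDeriv (k + 1) (fun s : ℝ => Real.exp (-s ^ 2)) = fun t =>
        -2 * t * iteratedDeriv k (fun s : ℝ => Real.exp (-s ^ 2)) t
        - 2 * (k * iteratedDeriv (k - 1) (fun s : ℝ => Real.exp (-s ^ 2)) t) := by
      funext t
      rw [ih]
      ring
    rw [h6] at h1
    rw [h1.unique h5]
    simp only [id, Nat.add_sub_cancel]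
    push_cast
    ring

theorem hasDerivAt_hermite1 (k : ℕ) (t : ℝ) :
    HasDerivAt (hermite1 k) (t * hermite1 k t + hermite1 (k + 1) t) t := by
  have h1 : HasDerivAt (fun t : ℝ => Real.exp (t ^ 2 / 2)) (Real.exp (t ^ 2 / 2) * t) t := by
    simpa using ((hasDerivAt_pow 2 t).div_const 2).exp
  refine (h1.mul (hasDerivAt_iteratedDeriv_gaussian k t)).congr_deriv ?_
  rw [hermite1, hermite1]
  ring

theorem hermite1_succ (k : ℕ) (t : ℝ) :
    hermite1 (k + 1) t = -2 * t * hermite1 k t - 2 * k * hermite1 (k - 1) t := by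
  rw [hermite1, iteratedDeriv_gaussian_succ, hermite1, hermite1]
  ring

variable {n : ℕ}

/-- Separates the factor in the `j`-th variable, so that partial derivatives and index shifts reduce
to one dimension. -/
theorem hermiteFun_update (α : Fin n → ℕ) (j : Fin n) (k : ℕ) (x : Fin n → ℝ) (t : ℝ) :
    hermiteFun (Function.update α j k) (x + t • Pi.single j 1) =
      ((hermite1 k (x j + t) * ∏ i ∈ Finset.univ.erase j, hermite1 (α i) (x i) : ℝ) : ℂ) := by
  rw [hermiteFun, ← Finset.mul_prod_erase _ _ (Finset.mem_univ j)]
  congr 2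
  · simp
  · refine Finset.prod_congr rfl fun i hi => ?_
    have := Finset.ne_of_mem_erase hi
    simp [this]

theorem lineDeriv_hermiteFun (α : Fin n → ℕ) (j : Fin n) (x : Fin n → ℝ) :
    lineDeriv ℝ (hermiteFun α) x (Pi.single j 1) =
      x j * hermiteFun α x + hermiteFun (Function.update α j (α j + 1)) x := by
  have h1 : (fun t : ℝ => hermiteFun α (x + t • Pi.single j 1)) = fun t : ℝ =>
      ((hermite1 (α j) (x j + t) * ∏ i ∈ Finset.univ.erase j, hermite1 (α i) (x i) : ℝ) : ℂ) := by
    funext t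
    rw [← hermiteFun_update, Function.update_eq_self]
  have h0 : HasDerivAt (fun t : ℝ => x j + t) 1 0 := (hasDerivAt_id 0).const_add _
  have h2 := (((hasDerivAt_hermite1 (α j) (x j + 0)).comp 0 h0).mul_const
    (∏ i ∈ Finset.univ.erase j, hermite1 (α i) (x i))).ofReal_comp
  rw [lineDeriv, h1]
  refine h2.deriv.trans ?_
  have h3 := hermiteFun_update α j (α j) x 0
  have h4 := hermiteFun_update α j (α j + 1) x 0
  simp only [zero_smul, add_zero, Function.update_eq_self] at h3 h4 ⊢
  rw [h3, h4]
  push_cast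
  ring

theorem hermiteFun_update_succ (α : Fin n → ℕ) (j : Fin n) (x : Fin n → ℝ) :
    hermiteFun (Function.update α j (α j + 1)) x =
      -2 * x j * hermiteFun α x - 2 * α j * hermiteFun (Function.update α j (α j - 1)) x := by
  have h3 := hermiteFun_update α j (α j) x 0
  have h4 := hermiteFun_update α j (α j + 1) x 0
  have h5 := hermiteFun_update α j (α j - 1) x 0
  simp only [zero_smul, add_zero, Function.update_eq_self] at h3 h4 h5 ⊢
  rw [h3, h4, h5, hermite1_succ]
  push_cast
  ring

theorem sum_update (α : Fin n → ℕ) (j : Fin n) (k : ℕ) :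
    ∑ i, Function.update α j k i + α j = ∑ i, α i + k := by
  rw [Finset.sum_update_of_mem (Finset.mem_univ j), Finset.sdiff_singleton_eq_erase,
    ← Finset.add_sum_erase _ _ (Finset.mem_univ j)]
  ring

/-- The creation operator `∂/∂x_j - x_j` maps `𝔚_l` to `𝔚_{l+1}`. -/
theorem creation_mem_hermiteSpace {l : ℕ} {f : Schw n} (hf : f ∈ hermiteSpace n l) (j : Fin n) :
    cliffordBasis n (Sum.inr j) f + Complex.I • cliffordBasis n (Sum.inl j) f
      ∈ hermiteSpace n (l + 1) := by
  suffices h : hermiteSpace n l ≤ (hermiteSpace n (l + 1)).comap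
      (cliffordBasis n (Sum.inr j) + Complex.I • cliffordBasis n (Sum.inl j)) from h hf
  refine Submodule.span_le.2 ?_
  rintro f ⟨α, hα, hf⟩
  refine Submodule.subset_span ⟨Function.update α j (α j + 1), ?_, fun x => ?_⟩
  · have := sum_update α j (α j + 1)
    omega
  · have hf' : (f : (Fin n → ℝ) → ℂ) = hermiteFun α := funext hf
    simp only [LinearMap.add_apply, LinearMap.smul_apply, _root_.add_apply, _root_.smul_apply,
      cliffordBasis_inl_apply, cliffordBasis_inr_apply, smul_eq_mul]
    rw [hf', lineDeriv_hermiteFun, ← mul_assoc, ← mul_assoc, Complex.I_mul_I]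
    ring

/-- The annihilation operator `∂/∂x_j + x_j` maps `𝔚_l` to `𝔚_{l-1}`. -/
theorem annihilation_mem_hermiteSpace {l : ℕ} {f : Schw n} (hf : f ∈ hermiteSpace n l)
    (j : Fin n) :
    cliffordBasis n (Sum.inr j) f - Complex.I • cliffordBasis n (Sum.inl j) f
      ∈ hermiteSpace n (l - 1) := by
  suffices h : hermiteSpace n l ≤ (hermiteSpace n (l - 1)).comap
      (cliffordBasis n (Sum.inr j) - Complex.I • cliffordBasis n (Sum.inl j)) from h hf
  refine Submodule.span_le.2 ?_
  rintro f ⟨α, hα, hf⟩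
  have hf' : (f : (Fin n → ℝ) → ℂ) = hermiteFun α := funext hf
  have key : ∀ x, (cliffordBasis n (Sum.inr j) - Complex.I • cliffordBasis n (Sum.inl j)) f x =
      -2 * α j * hermiteFun (Function.update α j (α j - 1)) x := fun x => by
    simp only [LinearMap.sub_apply, LinearMap.smul_apply, _root_.sub_apply, _root_.smul_apply,
      cliffordBasis_inl_apply, cliffordBasis_inr_apply, smul_eq_mul]
    rw [hf', lineDeriv_hermiteFun, hermiteFun_update_succ, ← mul_assoc, ← mul_assoc,
      Complex.I_mul_I]
    ring
  change _ ∈ hermiteSpace n (l - 1)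
  -- If `α j = 0` the image is zero. Otherwise `α j - 1` is a true predecessor and the degree drops
  -- to `l - 1`.
  rcases Nat.eq_zero_or_pos (α j) with h0 | h0
  · have : (cliffordBasis n (Sum.inr j) - Complex.I • cliffordBasis n (Sum.inl j)) f = 0 := by
      ext x
      rw [key, h0]
      simp
    rw [this]
    exact Submodule.zero_mem _
  · have h1 : (-2 * α j : ℂ) ≠ 0 := by
      simpa using h0.ne'
    rw [← smul_inv_smul₀ h1 ((cliffordBasis n (Sum.inr j) -
      Complex.I • cliffordBasis n (Sum.inl j)) f)]
    refine Submodule.smul_mem _ _ (Submodule.subset_span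
      ⟨Function.update α j (α j - 1), ?_, fun x => ?_⟩)
    · have := sum_update α j (α j - 1)
      omega
    · rw [_root_.smul_apply, key, smul_eq_mul, inv_mul_cancel_left₀ h1]

end Hermite

end SympDirac
end

/-! ### Dual bases and the Dirac operators on `Hom(V, 𝒮)` -/

noncomputable section

namespace SympDirac

/-- The canonical element `Σ_k X^k ⊗ X_k` does not depend on the basis. -/
theorem sum_dualBasis_invariant {ι M P : Type*} [Fintype ι] [AddCommGroup M] [Module ℝ M]
    [AddCommGroup P] [Module ℝ P] (X : Module.Basis ι ℝ M) (A : M ≃ₗ[ℝ] M)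
    (β : Module.Dual ℝ M →ₗ[ℝ] M →ₗ[ℝ] P) :
    ∑ k, β (X.coord k ∘ₗ A.symm.toLinearMap) (A (X k)) = ∑ k, β (X.coord k) (X k) := by
  have h1 : ∀ k, β (X.coord k ∘ₗ A.symm.toLinearMap) (A (X k)) =
      ∑ l, X.coord l (A (X k)) • β (X.coord k ∘ₗ A.symm.toLinearMap) (X l) := fun k => by
    conv_lhs => rw [← X.sum_repr (A (X k))]
    simp only [map_sum, map_smul, Module.Basis.coord_apply]
  -- The matrix of `A`, moved to the dual side, cancels `A⁻¹`: expanding `A⁻¹y` in the basis and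
  -- applying `X^l ∘ A` returns `X^l(y)`.
  have h2 : ∀ l, ∑ k, X.coord l (A (X k)) • (X.coord k ∘ₗ A.symm.toLinearMap) = X.coord l :=
    fun l => by
      ext y
      have h3 := congrArg (fun z => X.coord l (A z)) (X.sum_repr (A.symm y))
      simp only [map_sum, map_smul, LinearEquiv.apply_symm_apply] at h3
      rw [← h3]
      simp [mul_comm]
  simp only [h1]
  rw [Finset.sum_comm]
  refine Finset.sum_congr rfl fun l _ => ?_
  conv_rhs => rw [← h2 l]
  simp [LinearMap.sum_apply]

section

variable {E : Type*} [NormedAddCommGroup E] [NormedSpace ℝ E]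
  {F : Type*} [NormedAddCommGroup F] [NormedSpace ℝ F]
  {G : Type*} [TopologicalSpace G] [ChartedSpace E G] [Group G]
  {H : Subgroup G} [ChartedSpace F H] {n : ℕ} {S : HermitianSymmetricData E F H n}
  {V : Type*} [NormedAddCommGroup V] [NormedSpace ℂ V] [FiniteDimensional ℂ V]

theorem clifford_inl (j : Fin n) : S.clifford (S.X (Sum.inl j)) = cliffordBasis n (Sum.inl j) :=
  S.X.constr_basis ℝ _ _

theorem clifford_inr (j : Fin n) : S.clifford (S.X (Sum.inr j)) = cliffordBasis n (Sum.inr j) :=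
  S.X.constr_basis ℝ _ _

theorem ω₀_omegaBar (α : Module.Dual ℝ S.m) (Y : S.m) : S.ω₀ (S.omegaBar α) Y = α Y := by
  have : FiniteDimensional ℝ S.m := S.X.finiteDimensional_of_finite
  exact LinearMap.BilinForm.apply_toDual_symm_apply (hB := S.ω₀_nondegenerate) α Y

theorem g₀_gBar (α : Module.Dual ℝ S.m) (Y : S.m) : S.g₀ (S.gBar α) Y = α Y := by
  have : FiniteDimensional ℝ S.m := S.X.finiteDimensional_of_finite
  exact LinearMap.BilinForm.apply_toDual_symm_apply (hB := S.g₀_nondegenerate) α Y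

theorem eq_of_ω₀ {Y Z : S.m} (h : ∀ W, S.ω₀ Y W = S.ω₀ Z W) : Y = Z := by
  rw [← sub_eq_zero]
  exact S.ω₀_nondegenerate.1 _ fun W => by simp [h]

theorem eq_of_g₀ {Y Z : S.m} (h : ∀ W, S.g₀ Y W = S.g₀ Z W) : Y = Z := by
  rw [← sub_eq_zero]
  exact S.g₀_nondegenerate.1 _ fun W => by simp [h]

theorem ω₀_inr_inl (j k : Fin n) :
    S.ω₀ (S.X (Sum.inr j)) (S.X (Sum.inl k)) = if j = k then -1 else 0 := by
  rw [← S.ω₀_isAlt.neg_eq, S.symplectic_inl_inr]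
  split_ifs with h1 h2 h2 <;> simp_all

/-- The sign comes from `ω₀(X_{n+j}, X_j) = -1` and accounts for the relative sign of the two sums
in `𝒟_τ`. -/
theorem omegaBar_coord_inl (j : Fin n) :
    S.omegaBar (S.X.coord (Sum.inl j)) = -S.X (Sum.inr j) := by
  refine eq_of_ω₀ fun W => ?_
  rw [ω₀_omegaBar]
  refine DFunLike.congr_fun (f := S.X.coord (Sum.inl j)) (g := S.ω₀ (-S.X (Sum.inr j)))
    (S.X.ext fun k => ?_) W
  rcases k with k | k
  · simp [ω₀_inr_inl, Finsupp.single_apply, eq_comm]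
    split_ifs <;> simp
  · simp [S.symplectic_inr]

theorem omegaBar_coord_inr (j : Fin n) :
    S.omegaBar (S.X.coord (Sum.inr j)) = S.X (Sum.inl j) := by
  refine eq_of_ω₀ fun W => ?_
  rw [ω₀_omegaBar]
  refine DFunLike.congr_fun (f := S.X.coord (Sum.inr j)) (g := S.ω₀ (S.X (Sum.inl j)))
    (S.X.ext fun k => ?_) W
  rcases k with k | k
  · simp [S.symplectic_inl]
  · simp [S.symplectic_inl_inr, Finsupp.single_apply, eq_comm]

theorem J₀_inr (j : Fin n) : S.J₀ (S.X (Sum.inr j)) = -S.X (Sum.inl j) := by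
  rw [← S.unitary, S.J₀_sq]

/-- A unitary basis is orthonormal for `g₀`, which is why `ḡ` sends each dual basis vector to the
basis vector itself. -/
theorem g₀_basis (k l : Fin n ⊕ Fin n) : S.g₀ (S.X k) (S.X l) = if k = l then 1 else 0 := by
  rcases k with k | k <;> rcases l with l | l <;>
    simp [HermitianSymmetricData.g₀, S.unitary, J₀_inr, S.symplectic_inl, S.symplectic_inr,
      S.symplectic_inl_inr, ω₀_inr_inl, Sum.inl.injEq, Sum.inr.injEq]
  split_ifs <;> simp

theorem gBar_coord (k : Fin n ⊕ Fin n) : S.gBar (S.X.coord k) = S.X k := by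
  refine eq_of_g₀ fun W => ?_
  rw [g₀_gBar]
  refine DFunLike.congr_fun (f := S.X.coord k) (g := S.g₀ (S.X k)) (S.X.ext fun l => ?_) W
  simp [g₀_basis, Finsupp.single_apply, eq_comm]

/-! ### The operators on `Hom(V, 𝒮)` -/

/-- The operator `L ↦ - Σ_k b(X^k) · L ∘ τ_*(X_k)`. -/
def diracRep (b : Module.Dual ℝ S.m ≃ₗ[ℝ] S.m) (τ : Representation ℂ G V) (L : V →ₗ[ℂ] Schw n) :
    V →ₗ[ℂ] Schw n :=
  - ∑ k, S.clifford (b (S.X.coord k)) ∘ₗ L ∘ₗ repDeriv τ (S.X k).1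

theorem diracRep_apply (b : Module.Dual ℝ S.m ≃ₗ[ℝ] S.m) (τ : Representation ℂ G V)
    (L : V →ₗ[ℂ] Schw n) (v : V) :
    diracRep b τ L v = - ∑ k, S.clifford (b (S.X.coord k)) (L (repDeriv τ (S.X k).1 v)) := by
  simp [diracRep, LinearMap.sum_apply]

theorem diracRep_omegaBar (τ : Representation ℂ G V) (L : V →ₗ[ℂ] Schw n) :
    diracRep S.omegaBar τ L = S.dRep τ L := by
  simp only [diracRep, dRep, LinearMap.coe_mk, AddHom.coe_mk, Fintype.sum_sum_type, omegaBar_coord_inl, omegaBar_coord_inr, map_neg, LinearMap.neg_comp,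
    Finset.sum_neg_distrib]
  abel

theorem diracRep_gBar (τ : Representation ℂ G V) (L : V →ₗ[ℂ] Schw n) :
    diracRep S.gBar τ L = S.dTildeRep τ L := by
  simp only [diracRep, dTildeRep, LinearMap.coe_mk, AddHom.coe_mk, gBar_coord]

theorem repDeriv_add (τ : Representation ℂ G V) (Y Z : GroupLieAlgebra 𝓘(ℝ, E) G) :
    repDeriv τ (Y + Z) = repDeriv τ Y + repDeriv τ Z := by
  ext v
  exact DFunLike.congr_fun (map_add (repDiff E τ) Y Z) v

theorem repDeriv_smul (τ : Representation ℂ G V) (c : ℝ) (Y : GroupLieAlgebra 𝓘(ℝ, E) G) :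
    repDeriv τ (c • Y) = (c : ℂ) • repDeriv τ Y := by
  ext v
  exact (DFunLike.congr_fun (map_smul (repDiff E τ) c Y) v).trans (Complex.coe_smul _ _).symm

/-- The linear maps `V → 𝒮(ℝⁿ)` that intertwine the actions of `H`. -/
def equivariantMaps (κ : S.Lift) (τ : Representation ℂ G V) : Submodule ℂ (V →ₗ[ℂ] Schw n) where
  carrier := {L | ∀ (h : H) (v : V), incl n (L (τ h v)) = κ.lam h (incl n (L v))}
  zero_mem' := fun h v => by simp
  add_mem' := fun hL hM h v => by simp only [LinearMap.add_apply, map_add, hL h v, hM h v]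
  smul_mem' := fun c L hL h v => by simp only [LinearMap.smul_apply, map_smul, hL h v]

omit [FiniteDimensional ℂ V] in
theorem spaceU_le_equivariantMaps (κ : S.Lift) (τ : Representation ℂ G V) :
    spaceU κ τ ≤ equivariantMaps κ τ :=
  iSup_le fun _ _ hL => hL.2

omit [FiniteDimensional ℂ V] in
theorem mem_homH_iff (κ : S.Lift) (τ : Representation ℂ G V) (l : ℕ) (L : V →ₗ[ℂ] Schw n) :
    L ∈ homH κ τ l ↔ (∀ v, L v ∈ hermiteSpace n l) ∧ L ∈ equivariantMaps κ τ := Iff.rfl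

/-- Moving `λ(h)` through the sum applies `κ(h)` to both tensor factors of `Σ_k X^k ⊗ X_k`, and this
element is invariant. -/
theorem diracRep_equivariant (κ : S.Lift) {τ : Representation ℂ G V}
    (hτ : ∀ (h : H) (Y : S.m) (v : V),
      τ h (repDeriv τ Y.1 v) = repDeriv τ (isotropy κ h Y).1 (τ h v))
    {b : Module.Dual ℝ S.m ≃ₗ[ℝ] S.m}
    (hb : ∀ (h : H) (α : Module.Dual ℝ S.m),
      isotropy κ h (b α) = b (α ∘ₗ (isotropy κ h).symm.toLinearMap))
    {L : V →ₗ[ℂ] Schw n} (hL : L ∈ equivariantMaps κ τ) :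
    diracRep b τ L ∈ equivariantMaps κ τ := by
  intro h v
  have h1 : ∀ k, κ.lam h (incl n (S.clifford (b (S.X.coord k)) (L (repDeriv τ (S.X k).1 v)))) =
      incl n (S.clifford (b (S.X.coord k ∘ₗ (isotropy κ h).symm.toLinearMap))
        (L (repDeriv τ (isotropy κ h (S.X k)).1 (τ h v)))) := fun k => by
    rw [lam_clifford κ h _ (hL h _).symm, hτ, hb]
  rw [diracRep_apply, diracRep_apply]
  simp only [map_neg, map_sum, h1]
  congr 1
  simp only [← map_sum]
  congr 1
  -- Both `b` and `τ_*` are only real linear on their arguments, so the pairing is formed over `ℝ`.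
  let β : Module.Dual ℝ S.m →ₗ[ℝ] S.m →ₗ[ℝ] Schw n :=
    LinearMap.mk₂ ℝ (fun α Y => S.clifford (b α) (L (repDeriv τ Y.1 (τ h v))))
      (fun α α' Y => by simp) (fun c α Y => by simp)
      (fun α Y Z => by simp [repDeriv_add])
      (fun c α Y => by
        change S.clifford (b α) (L (repDeriv τ (c • Y.1) (τ h v))) = _
        simp [repDeriv_smul])
  exact (sum_dualBasis_invariant S.X (isotropy κ h) β).symm

theorem omegaBar_equivariant (κ : S.Lift) (h : H) (α : Module.Dual ℝ S.m) :
    isotropy κ h (S.omegaBar α) = S.omegaBar (α ∘ₗ (isotropy κ h).symm.toLinearMap) := by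
  refine eq_of_ω₀ fun W => ?_
  have h1 := ω₀_isotropy κ h (S.omegaBar α) ((isotropy κ h).symm W)
  rw [LinearEquiv.apply_symm_apply] at h1
  rw [h1, ω₀_omegaBar, ω₀_omegaBar]
  rfl

theorem gBar_equivariant (κ : S.Lift) (h : H)
    (hg : ∀ X Y, S.g₀ (isotropy κ h X) (isotropy κ h Y) = S.g₀ X Y) (α : Module.Dual ℝ S.m) :
    isotropy κ h (S.gBar α) = S.gBar (α ∘ₗ (isotropy κ h).symm.toLinearMap) := by
  refine eq_of_g₀ fun W => ?_
  have h1 := hg (S.gBar α) ((isotropy κ h).symm W)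
  rw [LinearEquiv.apply_symm_apply] at h1
  rw [h1, g₀_gBar, g₀_gBar]
  rfl

/-- The combination `𝒟̃_τ + i 𝒟_τ` acts by creation operators. -/
theorem dTildeRep_add_dRep (τ : Representation ℂ G V) (L : V →ₗ[ℂ] Schw n) (v : V) :
    (S.dTildeRep τ L + Complex.I • S.dRep τ L) v =
      Complex.I • ∑ j,
        (fun f : Schw n => cliffordBasis n (Sum.inr j) f + Complex.I • cliffordBasis n (Sum.inl j) f)
        (L (repDeriv τ (S.X (Sum.inl j)).1 v + Complex.I • repDeriv τ (S.X (Sum.inr j)).1 v)) := by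
  have e1 : S.dTildeRep τ L v = -(∑ j, cliffordBasis n (Sum.inl j) (L (repDeriv τ (S.X (Sum.inl j)).1 v))
      + ∑ j, cliffordBasis n (Sum.inr j) (L (repDeriv τ (S.X (Sum.inr j)).1 v))) := by
    simp [dTildeRep, LinearMap.sum_apply, clifford_inl, clifford_inr]
  have e2 : S.dRep τ L v = -(∑ j, cliffordBasis n (Sum.inl j) (L (repDeriv τ (S.X (Sum.inr j)).1 v)))
      + ∑ j, cliffordBasis n (Sum.inr j) (L (repDeriv τ (S.X (Sum.inl j)).1 v)) := by
    simp [dRep, LinearMap.sum_apply, clifford_inl, clifford_inr]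
  rw [LinearMap.add_apply, LinearMap.smul_apply, e1, e2]
  simp only [map_add, map_smul, smul_add, smul_neg, Finset.sum_add_distrib, Finset.smul_sum,
    smul_smul, Complex.I_mul_I, neg_smul, one_smul, Finset.sum_neg_distrib]
  abel

/-- The opposite sign of `i` pairs `∂_j + x_j` with `τ_*(X_j) - iτ_*(X_{n+j})`, leaving annihilation
operators only. -/
theorem dTildeRep_sub_dRep (τ : Representation ℂ G V) (L : V →ₗ[ℂ] Schw n) (v : V) :
    (S.dTildeRep τ L - Complex.I • S.dRep τ L) v =
      -Complex.I • ∑ j,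
        (fun f : Schw n => cliffordBasis n (Sum.inr j) f - Complex.I • cliffordBasis n (Sum.inl j) f)
        (L (repDeriv τ (S.X (Sum.inl j)).1 v - Complex.I • repDeriv τ (S.X (Sum.inr j)).1 v)) := by
  have e1 : S.dTildeRep τ L v = -(∑ j, cliffordBasis n (Sum.inl j) (L (repDeriv τ (S.X (Sum.inl j)).1 v))
      + ∑ j, cliffordBasis n (Sum.inr j) (L (repDeriv τ (S.X (Sum.inr j)).1 v))) := by
    simp [dTildeRep, LinearMap.sum_apply, clifford_inl, clifford_inr]
  have e2 : S.dRep τ L v = -(∑ j, cliffordBasis n (Sum.inl j) (L (repDeriv τ (S.X (Sum.inr j)).1 v)))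
      + ∑ j, cliffordBasis n (Sum.inr j) (L (repDeriv τ (S.X (Sum.inl j)).1 v)) := by
    simp [dRep, LinearMap.sum_apply, clifford_inl, clifford_inr]
  rw [LinearMap.sub_apply, LinearMap.smul_apply, e1, e2]
  simp only [map_sub, map_smul, smul_add, smul_sub, smul_neg, Finset.sum_sub_distrib,
    Finset.smul_sum, smul_smul, Complex.I_mul_I, neg_mul, neg_smul, one_smul,
    Finset.sum_neg_distrib, neg_neg]
  abel

/-- The operators `𝒟_τ` and `𝒟̃_τ` map `U` into itself. -/
theorem dRep_dTildeRep_mem_spaceU (κ : S.Lift) {τ : Representation ℂ G V}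
    (hd : ∀ L ∈ equivariantMaps κ τ, S.dRep τ L ∈ equivariantMaps κ τ)
    (ht : ∀ L ∈ equivariantMaps κ τ, S.dTildeRep τ L ∈ equivariantMaps κ τ)
    {L : V →ₗ[ℂ] Schw n} (hL : L ∈ spaceU κ τ) :
    S.dRep τ L ∈ spaceU κ τ ∧ S.dTildeRep τ L ∈ spaceU κ τ := by
  suffices h : spaceU κ τ ≤ (spaceU κ τ).comap (S.dRep τ) ⊓ (spaceU κ τ).comap (S.dTildeRep τ) from
    h hL
  refine iSup_le fun l L hL => ?_
  have h1 : S.dTildeRep τ L + Complex.I • S.dRep τ L ∈ spaceU κ τ := by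
    refine (le_iSup (homH κ τ) (l + 1)) ((mem_homH_iff κ τ _ _).2 ⟨fun v => ?_,
      Submodule.add_mem _ (ht L hL.2) (Submodule.smul_mem _ _ (hd L hL.2))⟩)
    rw [dTildeRep_add_dRep]
    exact Submodule.smul_mem _ _ (Submodule.sum_mem _ fun j _ =>
      creation_mem_hermiteSpace (hL.1 _) j)
  have h2 : S.dTildeRep τ L - Complex.I • S.dRep τ L ∈ spaceU κ τ := by
    -- For `l = 0` the truncated `l - 1` is `0`; the annihilation operators kill `𝔚_0`, so the
    -- membership still holds.
    refine (le_iSup (homH κ τ) (l - 1)) ((mem_homH_iff κ τ _ _).2 ⟨fun v => ?_,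
      Submodule.sub_mem _ (ht L hL.2) (Submodule.smul_mem _ _ (hd L hL.2))⟩)
    rw [dTildeRep_sub_dRep]
    exact Submodule.smul_mem _ _ (Submodule.sum_mem _ fun j _ =>
      annihilation_mem_hermiteSpace (hL.1 _) j)
  have h3 : S.dTildeRep τ L = (2⁻¹ : ℂ) • ((S.dTildeRep τ L + Complex.I • S.dRep τ L) +
      (S.dTildeRep τ L - Complex.I • S.dRep τ L)) := by
    rw [add_add_sub_cancel, ← two_smul ℂ, inv_smul_smul₀ two_ne_zero]
  have h4 : S.dRep τ L = (2 * Complex.I)⁻¹ • ((S.dTildeRep τ L + Complex.I • S.dRep τ L) -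
      (S.dTildeRep τ L - Complex.I • S.dRep τ L)) := by
    rw [add_sub_sub_cancel, ← two_smul ℂ, smul_smul 2,
      inv_smul_smul₀ (mul_ne_zero two_ne_zero Complex.I_ne_zero)]
  refine ⟨?_, ?_⟩
  · change S.dRep τ L ∈ spaceU κ τ
    rw [h4]
    exact Submodule.smul_mem _ _ (Submodule.sub_mem _ h1 h2)
  · change S.dTildeRep τ L ∈ spaceU κ τ
    rw [h3]
    exact Submodule.smul_mem _ _ (Submodule.add_mem _ h1 h2)

end

end SympDirac
end

noncomputable section

namespace SympDirac

/-! ### Values of partially defined operators -/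

section PMap

variable {A : Type*} [AddCommGroup A] [Module ℂ A]

/-- Domain membership and value are carried in one existential, so that the natural domain of `𝒫` is
verified along with its formula. -/
theorem exists_pcomp_apply {T U : A →ₗ.[ℂ] A} {x y z : A} (hU : ∃ h : x ∈ U.domain, U ⟨x, h⟩ = y)
    (hT : ∃ h : y ∈ T.domain, T ⟨y, h⟩ = z) :
    ∃ h : x ∈ (pcomp T U).domain, pcomp T U ⟨x, h⟩ = z := by
  obtain ⟨hx, rfl⟩ := hU
  obtain ⟨hy, rfl⟩ := hT
  exact ⟨⟨⟨x, hx⟩, hy, rfl⟩, rfl⟩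

theorem exists_sub_apply {T U : A →ₗ.[ℂ] A} {x y z : A} (hT : ∃ h : x ∈ T.domain, T ⟨x, h⟩ = y)
    (hU : ∃ h : x ∈ U.domain, U ⟨x, h⟩ = z) :
    ∃ h : x ∈ (T - U).domain, (T - U) ⟨x, h⟩ = y - z := by
  obtain ⟨hx, rfl⟩ := hT
  obtain ⟨hy, rfl⟩ := hU
  exact ⟨⟨hx, hy⟩, LinearPMap.sub_apply _ _ _⟩

theorem exists_smul_apply {T : A →ₗ.[ℂ] A} {x y : A} (c : ℂ) (hT : ∃ h : x ∈ T.domain, T ⟨x, h⟩ = y) :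
    ∃ h : x ∈ (c • T).domain, (c • T) ⟨x, h⟩ = c • y := by
  obtain ⟨hx, rfl⟩ := hT
  exact ⟨hx, LinearPMap.smul_apply _ _ _⟩

end PMap

/-! ### Smooth representations and the derivatives of `v ⊗ L` -/

section

variable {E : Type*} [NormedAddCommGroup E] [NormedSpace ℝ E]
  {G : Type*} [TopologicalSpace G] [ChartedSpace E G] [Group G] [LieGroup 𝓘(ℝ, E) ∞ G]
  {V : Type*} [NormedAddCommGroup V] [NormedSpace ℂ V] [FiniteDimensional ℂ V]

/-- A representation as a family of continuous linear maps. -/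
def repCLM (τ : Representation ℂ G V) (g : G) : V →L[ℂ] V := LinearMap.toContinuousLinearMap (τ g)

omit [TopologicalSpace G] [ChartedSpace E G] [LieGroup 𝓘(ℝ, E) ∞ G] in
theorem repCLM_mul (τ : Representation ℂ G V) (g g' : G) :
    repCLM τ (g * g') = repCLM τ g * repCLM τ g' := by
  ext v
  exact DFunLike.congr_fun (map_mul τ g g') v

omit [TopologicalSpace G] [ChartedSpace E G] [LieGroup 𝓘(ℝ, E) ∞ G] in
theorem repCLM_one (τ : Representation ℂ G V) : repCLM τ (1 : G) = 1 := by
  ext v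
  exact DFunLike.congr_fun (map_one τ) v

omit [LieGroup 𝓘(ℝ, E) ∞ G] in
theorem hasMFDerivAt_repCLM {τ : Representation ℂ G V} (hτ : IsSmoothRep E τ) :
    HasMFDerivAt 𝓘(ℝ, E) 𝓘(ℝ, V →L[ℂ] V) (repCLM τ) 1 (repDiff E τ) :=
  (ContMDiff.mdifferentiable hτ (by simp) 1).hasMFDerivAt

/-- The differential of a representation intertwines the adjoint representation. -/
theorem repDeriv_Ad {τ : Representation ℂ G V} (hτ : IsSmoothRep E τ) (g : G)
    (Y : GroupLieAlgebra 𝓘(ℝ, E) G) (v : V) :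
    τ g (repDeriv τ Y v) = repDeriv τ (Ad (E := E) g Y) (τ g v) := by
  have h1 := hasMFDerivAt_repCLM hτ
  have h2 : HasMFDerivAt 𝓘(ℝ, E) 𝓘(ℝ, V →L[ℂ] V) (repCLM τ) (g * 1 * g⁻¹) (repDiff E τ) := by
    have h3 : ∀ x : G, x = 1 →
        HasMFDerivAt 𝓘(ℝ, E) 𝓘(ℝ, V →L[ℂ] V) (repCLM τ) x (repDiff E τ) := by
      rintro _ rfl
      exact h1
    exact h3 _ (by simp)
  have h3 : HasMFDerivAt 𝓘(ℝ, E) 𝓘(ℝ, E) (fun x : G => g * x * g⁻¹) 1 (Ad (E := E) g) :=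
    (mdifferentiableAt_conj (E := E) g 1).hasMFDerivAt
  have h4 : HasMFDerivAt 𝓘(ℝ, E) 𝓘(ℝ, V →L[ℂ] V) (fun x : G => repCLM τ (g * x * g⁻¹)) 1
      ((repDiff E τ).comp (Ad (E := E) g : E →L[ℝ] E)) := HasMFDerivAt.comp (M' := G) 1 h2 h3
  obtain ⟨-, h5⟩ := hasMFDerivAt_vector_iff.1 h4
  obtain ⟨-, h6⟩ := hasMFDerivAt_vector_iff.1 h1
  -- The second computation of the derivative, from `τ(gxg⁻¹) = τ(g)τ(x)τ(g⁻¹)`; the first was the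
  -- chain rule through `Ad(g)`.
  have h7 := (h6.const_mul (repCLM τ g)).mul_const' (repCLM τ g⁻¹)
  have h8 := h5.unique (h7.congr_of_eventuallyEq (Filter.Eventually.of_forall fun u => by
    simp only [repCLM_mul]))
  have h9 := DFunLike.congr_fun (DFunLike.congr_fun h8 (Y : E)) (τ g v)
  have h10 : τ g⁻¹ (τ g v) = v := by
    rw [← Module.End.mul_apply, ← map_mul, inv_mul_cancel, map_one]; rfl
  have h11 : repDeriv τ (Ad (E := E) g Y) (τ g v) =
      τ g (repDeriv τ Y (τ g⁻¹ (τ g v))) := h9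
  rw [h11, h10]

variable {n : ℕ}

/-- The function on `G` that is associated with `v ⊗ L`. -/
def matrixField (τ : Representation ℂ G V) (v : V) (L : V →ₗ[ℂ] Schw n) (g : G) : L2 n :=
  incl n (L (τ g⁻¹ v))

omit [TopologicalSpace G] [FiniteDimensional ℂ V] in
theorem frobenius_tmul (τ : Representation ℂ G V) (v : V) (L : V →ₗ[ℂ] Schw n) :
    frobenius n τ (v ⊗ₜ[ℂ] L) = matrixField τ v L := by
  rw [HermitianSymmetricData.frobenius, TensorProduct.lift.tmul]
  rfl

/-- The continuous linear map `A ↦ L(A v)`. -/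
def evalCLM (L : V →ₗ[ℂ] Schw n) (v : V) : (V →L[ℂ] V) →L[ℝ] L2 n :=
  ((LinearMap.toContinuousLinearMap (incl n ∘ₗ L)).comp
    (ContinuousLinearMap.apply ℂ V v)).restrictScalars ℝ

omit [TopologicalSpace G] in
theorem matrixField_eq (τ : Representation ℂ G V) (v : V) (L : V →ₗ[ℂ] Schw n) :
    matrixField τ v L = fun g => evalCLM L v (repCLM τ g⁻¹) := rfl

theorem contMDiff_matrixField {τ : Representation ℂ G V} (hτ : IsSmoothRep E τ) (v : V)
    (L : V →ₗ[ℂ] Schw n) : ContMDiff 𝓘(ℝ, E) 𝓘(ℝ, L2 n) ∞ (matrixField τ v L) := by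
  rw [matrixField_eq]
  have h1 : ContMDiff 𝓘(ℝ, E) 𝓘(ℝ, V →L[ℂ] V) ∞ (repCLM τ) := hτ
  exact (evalCLM L v).contDiff.contMDiff.comp (h1.comp (contMDiff_inv 𝓘(ℝ, E) ∞))

/-- Differentiating `f g = 1` at a point where both factors are `1` gives `f' + g' = 0`. -/
theorem hasFDerivAt_inverse_eq_neg {A : Type*} [NormedRing A] [NormedAlgebra ℝ A] {f g : E → A}
    {x : E} {f' g' : E →L[ℝ] A} (hf : HasFDerivAt f f' x) (hg : HasFDerivAt g g' x)
    (hfx : f x = 1) (hgx : g x = 1) (hfg : ∀ u, f u * g u = 1) : g' = -f' := by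
  have h1 := (hf.mul' hg).unique ((hasFDerivAt_const (1 : A) x).congr_of_eventuallyEq
    (Filter.Eventually.of_forall hfg))
  ext y
  have h2 := DFunLike.congr_fun h1 y
  simp [hfx, hgx] at h2
  exact eq_neg_of_add_eq_zero_left h2

theorem hasMFDerivAt_repCLM_inv {τ : Representation ℂ G V} (hτ : IsSmoothRep E τ) :
    HasMFDerivAt 𝓘(ℝ, E) 𝓘(ℝ, V →L[ℂ] V) (fun x : G => repCLM τ x⁻¹) 1 (-repDiff E τ) := by
  have h1 : MDifferentiableAt 𝓘(ℝ, E) 𝓘(ℝ, V →L[ℂ] V) (fun x : G => repCLM τ x⁻¹) 1 :=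
    (ContMDiff.comp (g := repCLM τ) hτ (contMDiff_inv 𝓘(ℝ, E) ∞)).mdifferentiable (by simp) 1
  obtain ⟨D, hD⟩ : ∃ D : E →L[ℝ] (V →L[ℂ] V),
      HasMFDerivAt 𝓘(ℝ, E) 𝓘(ℝ, V →L[ℂ] V) (fun x : G => repCLM τ x⁻¹) 1 D :=
    ⟨_, h1.hasMFDerivAt⟩
  obtain ⟨-, h2⟩ := hasMFDerivAt_vector_iff.1 (hasMFDerivAt_repCLM hτ)
  obtain ⟨-, h3⟩ := hasMFDerivAt_vector_iff.1 hD
  have h5 : D = -repDiff E τ := by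
    refine hasFDerivAt_inverse_eq_neg h2 h3 ?_ ?_ fun u => ?_
    · rw [extChartAt_to_inv, repCLM_one]
    · rw [extChartAt_to_inv, inv_one, repCLM_one]
    · rw [← repCLM_mul, mul_inv_cancel, repCLM_one]
  rwa [h5] at hD

omit [Group G] [LieGroup 𝓘(ℝ, E) ∞ G] in
theorem hasMFDerivAt_congr_point {W : Type*} [NormedAddCommGroup W] [NormedSpace ℝ W] {φ : G → W}
    {x y : G} (h : x = y) (hφ : MDifferentiableAt 𝓘(ℝ, E) 𝓘(ℝ, W) φ y) :
    HasMFDerivAt 𝓘(ℝ, E) 𝓘(ℝ, W) φ x (mfderiv 𝓘(ℝ, E) 𝓘(ℝ, W) φ y : E →L[ℝ] W) := by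
  subst h
  exact hφ.hasMFDerivAt

/-- The derivative along a left invariant field is computed from the left translates. -/
theorem leftDeriv_eq {φ : G → L2 n} {g : G} (hφ : MDifferentiableAt 𝓘(ℝ, E) 𝓘(ℝ, L2 n) φ g)
    {D : E →L[ℝ] L2 n} (hD : HasMFDerivAt 𝓘(ℝ, E) 𝓘(ℝ, L2 n) (fun x : G => φ (g * x)) 1 D)
    (Y : GroupLieAlgebra 𝓘(ℝ, E) G) : leftDeriv Y φ g = D Y := by
  have h1 := HasMFDerivAt.comp (M' := G) 1 (hasMFDerivAt_congr_point (x := g * 1) (y := g) (mul_one g) hφ)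
    (mdifferentiableAt_mul_left (E := E) g 1).hasMFDerivAt
  exact DFunLike.congr_fun (hasMFDerivAt_unique h1 hD) Y

/-- From `τ((gx)⁻¹) = τ(x⁻¹)τ(g⁻¹)` one only has to differentiate `x ↦ τ(x⁻¹)` at the unit, whence
the minus sign. The result is again the image of a Schwartz function. -/
theorem leftDeriv_matrixField {τ : Representation ℂ G V} (hτ : IsSmoothRep E τ)
    (Y : GroupLieAlgebra 𝓘(ℝ, E) G) (v : V) (L : V →ₗ[ℂ] Schw n) (g : G) :
    leftDeriv Y (matrixField τ v L) g = -incl n (L (repDeriv τ Y (τ g⁻¹ v))) := by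
  have h1 : (fun x : G => matrixField τ v L (g * x)) =
      fun x => evalCLM L (τ g⁻¹ v) (repCLM τ x⁻¹) := by
    funext x
    rw [matrixField, mul_inv_rev, map_mul]
    rfl
  have h2 : HasMFDerivAt 𝓘(ℝ, E) 𝓘(ℝ, L2 n) (fun x : G => matrixField τ v L (g * x)) 1
      ((evalCLM L (τ g⁻¹ v)).comp (-repDiff E τ)) := by
    rw [h1]
    obtain ⟨h3, h4⟩ := hasMFDerivAt_vector_iff.1 (hasMFDerivAt_repCLM_inv hτ)
    exact hasMFDerivAt_vector_iff.2 ⟨(evalCLM L (τ g⁻¹ v)).continuous.continuousAt.comp h3,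
      (evalCLM L (τ g⁻¹ v)).hasFDerivAt.comp _ h4⟩
  rw [leftDeriv_eq ((contMDiff_matrixField hτ v L).mdifferentiable (by simp) g) h2 Y]
  have h5 : evalCLM L (τ g⁻¹ v) (-repDiff E τ (Y : E)) =
      -evalCLM L (τ g⁻¹ v) (repDiff E τ (Y : E)) := map_neg _ _
  exact h5

end

end SympDirac
end

noncomputable section

namespace SympDirac

/-! ### Dirac operators on `V ⊗ U` -/

section

variable {E : Type*} [NormedAddCommGroup E] [NormedSpace ℝ E]
  {F : Type*} [NormedAddCommGroup F] [NormedSpace ℝ F]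
  {G : Type*} [TopologicalSpace G] [ChartedSpace E G] [Group G]
  {H : Subgroup G} [ChartedSpace F H] {n : ℕ} {S : HermitianSymmetricData E F H n}
  {V : Type*} [NormedAddCommGroup V] [NormedSpace ℂ V] [FiniteDimensional ℂ V]

theorem cliffordL2_toFun (Y : S.m) (w : LinearMap.range (incl n)) {f : Schw n}
    (hw : w.1 = incl n f) : (S.cliffordL2 Y).toFun w = incl n (S.clifford Y f) := by
  have h1 : w = LinearEquiv.ofInjective (incl n) (incl_injective n) f := Subtype.ext hw
  rw [h1]
  change incl n (S.clifford Y ((LinearEquiv.ofInjective (incl n) (incl_injective n)).symm _)) = _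
  rw [LinearEquiv.symm_apply_apply]

omit [FiniteDimensional ℂ V] in
-- Elementary tensors span, and domains and `V ⊗ U` are subspaces, so the formula on `v ⊗ L`
-- suffices.
theorem isInvariantUnder_spaceVU (κ : S.Lift) (τ : Representation ℂ G V)
    (T : (G → L2 n) →ₗ.[ℂ] (G → L2 n)) (D : (V →ₗ[ℂ] Schw n) → (V →ₗ[ℂ] Schw n))
    (hD : ∀ L ∈ spaceU κ τ, D L ∈ spaceU κ τ)
    (hT : ∀ (v : V), ∀ L ∈ spaceU κ τ,
      ∃ h : HermitianSymmetricData.frobenius n τ (v ⊗ₜ[ℂ] L) ∈ T.domain,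
        T ⟨_, h⟩ = HermitianSymmetricData.frobenius n τ (v ⊗ₜ[ℂ] D L)) :
    IsInvariantUnder (spaceVU κ τ) T := by
  have key : ∀ t : V ⊗[ℂ] spaceU κ τ,
      ∃ h : (HermitianSymmetricData.frobenius n τ ∘ₗ LinearMap.lTensor V (spaceU κ τ).subtype) t
        ∈ T.domain, T ⟨_, h⟩ ∈ spaceVU κ τ := by
    intro t
    induction t using TensorProduct.induction_on with
    | zero =>
      rw [map_zero]
      refine ⟨Submodule.zero_mem _, ?_⟩
      change T 0 ∈ _
      rw [T.map_zero]
      exact Submodule.zero_mem _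
    | tmul v L =>
      obtain ⟨h1, h2⟩ := hT v L.1 L.2
      exact ⟨h1, ⟨v ⊗ₜ ⟨D L.1, hD L.1 L.2⟩, h2.symm⟩⟩
    | add t s ht hs =>
      obtain ⟨h1, h2⟩ := ht
      obtain ⟨h3, h4⟩ := hs
      rw [map_add]
      refine ⟨Submodule.add_mem _ h1 h3, ?_⟩
      change T (⟨_, h1⟩ + ⟨_, h3⟩) ∈ _
      rw [T.map_add]
      exact Submodule.add_mem _ h2 h4
  refine ⟨?_, ?_⟩
  · rintro _ ⟨t, rfl⟩
    exact (key t).1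
  · rintro _ ⟨t, rfl⟩
    exact (key t).2

variable [LieGroup 𝓘(ℝ, E) ∞ G]

theorem matrixField_mem_spinorFields (κ : S.Lift) {τ : Representation ℂ G V}
    (hτ : IsSmoothRep E τ) (v : V) {L : V →ₗ[ℂ] Schw n} (hL : L ∈ equivariantMaps κ τ) :
    matrixField τ v L ∈ spinorFields κ := by
  refine ⟨contMDiff_matrixField hτ v L, fun g h => ?_⟩
  rw [matrixField, mul_inv_rev, map_mul]
  exact hL h⁻¹ (τ g⁻¹ v)

theorem matrixField_mem_preDomain (κ : S.Lift) {τ : Representation ℂ G V}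
    (hτ : IsSmoothRep E τ) (v : V) {L : V →ₗ[ℂ] Schw n} (hL : L ∈ equivariantMaps κ τ) :
    matrixField τ v L ∈ preDomain κ := by
  refine ⟨matrixField_mem_spinorFields κ hτ v hL, fun g Y => ?_⟩
  rw [leftDeriv_matrixField hτ, ← map_neg]
  exact ⟨_, rfl⟩

/-- The symplectic Dirac operators act on `v ⊗ L` through the second factor. -/
theorem dirac_matrixField (κ : S.Lift) {τ : Representation ℂ G V} (hτ : IsSmoothRep E τ) (v : V)
    (b : Module.Dual ℝ S.m ≃ₗ[ℝ] S.m) {L : V →ₗ[ℂ] Schw n} (hL : L ∈ equivariantMaps κ τ)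
    (hb : diracRep b τ L ∈ equivariantMaps κ τ) :
    ∃ h : matrixField τ v L ∈ (dirac κ b).domain,
      dirac κ b ⟨_, h⟩ = matrixField τ v (diracRep b τ L) := by
  refine exists_pcomp_apply (y := matrixField τ v (diracRep b τ L))
    ⟨matrixField_mem_preDomain κ hτ v hL, ?_⟩
    ⟨matrixField_mem_spinorFields κ hτ v hb, rfl⟩
  funext g
  have h1 : ∀ k, (S.cliffordL2 (b (S.X.coord k))).toFun
      (preDeriv κ (S.X k) g ⟨_, matrixField_mem_preDomain κ hτ v hL⟩) =
      incl n (S.clifford (b (S.X.coord k)) (-L (repDeriv τ (S.X k).1 (τ g⁻¹ v)))) := fun k =>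
    cliffordL2_toFun _ _ ((leftDeriv_matrixField hτ _ v L g).trans (map_neg _ _).symm)
  have h2 : preDirac κ b ⟨_, matrixField_mem_preDomain κ hτ v hL⟩ g =
      ∑ k, (S.cliffordL2 (b (S.X.coord k))).toFun
        (preDeriv κ (S.X k) g ⟨_, matrixField_mem_preDomain κ hτ v hL⟩) := by
    change (∑ k, (S.cliffordL2 (b (S.X.coord k))).toFun ∘ₗ preDeriv κ (S.X k) g)
      (⟨_, matrixField_mem_preDomain κ hτ v hL⟩ : preDomain κ) = _
    rw [LinearMap.sum_apply]
    rfl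
  rw [h2, matrixField, diracRep_apply]
  simp only [h1, map_neg, map_sum, Finset.sum_neg_distrib]

end

end SympDirac
end

/-! ### The main theorem -/

theorem mainTheorem2
    {E : Type*} [NormedAddCommGroup E] [NormedSpace ℝ E] [FiniteDimensional ℝ E]
    {G : Type*} [TopologicalSpace G] [ChartedSpace E G] [Group G] [LieGroup 𝓘(ℝ, E) ∞ G]
    [T2Space G] [CompactSpace G] [SimplyConnectedSpace G]
    {F : Type*} [NormedAddCommGroup F] [NormedSpace ℝ F] [FiniteDimensional ℝ F]
    (H : Subgroup G) [ChartedSpace F H] [LieGroup 𝓘(ℝ, F) ∞ H]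
    (hH_incl : ContMDiff 𝓘(ℝ, F) 𝓘(ℝ, E) ∞ (Subtype.val : H → G))
    (hH_closed : IsClosed (H : Set G)) (hH_conn : IsConnected (H : Set G))
    {n : ℕ} (S : HermitianSymmetricData E F H n) (κ : S.Lift)
    {V : Type*} [NormedAddCommGroup V] [NormedSpace ℂ V] [FiniteDimensional ℂ V]
    (τ : Representation ℂ G V) (hτ_smooth : IsSmoothRep E τ) (hτ_irr : τ.IsIrreducible) :
    IsInvariantUnder (spaceVU κ τ) (diracDTilde κ) ∧
    IsInvariantUnder (spaceVU κ τ) (opP κ) ∧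
    (∀ L ∈ spaceU κ τ,
      S.dRep τ L ∈ spaceU κ τ ∧ S.dTildeRep τ L ∈ spaceU κ τ ∧ S.pRep τ L ∈ spaceU κ τ) ∧
    (∀ (v : V) (L : V →ₗ[ℂ] Schw n), L ∈ spaceU κ τ →
      (∃ h : frobenius n τ (v ⊗ₜ[ℂ] L) ∈ (diracDTilde κ).domain,
        diracDTilde κ ⟨frobenius n τ (v ⊗ₜ[ℂ] L), h⟩
          = frobenius n τ (v ⊗ₜ[ℂ] S.dTildeRep τ L)) ∧
      (∃ h : frobenius n τ (v ⊗ₜ[ℂ] L) ∈ (opP κ).domain,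
        opP κ ⟨frobenius n τ (v ⊗ₜ[ℂ] L), h⟩
          = frobenius n τ (v ⊗ₜ[ℂ] S.pRep τ L))) := by
  have hAd : ∀ (h : H) (Y : S.m) (v : V),
      τ h (repDeriv τ Y.1 v) = repDeriv τ (isotropy κ h Y).1 (τ h v) := fun h Y v => by
    rw [coe_isotropy]
    exact repDeriv_Ad hτ_smooth (h : G) Y.1 v
  have hd : ∀ L ∈ equivariantMaps κ τ, S.dRep τ L ∈ equivariantMaps κ τ := fun L hL => by
    rw [← diracRep_omegaBar]
    exact diracRep_equivariant κ hAd (omegaBar_equivariant κ) hL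
  have ht : ∀ L ∈ equivariantMaps κ τ, S.dTildeRep τ L ∈ equivariantMaps κ τ := fun L hL => by
    rw [← diracRep_gBar]
    exact diracRep_equivariant κ hAd
      (fun h => gBar_equivariant κ h (g₀_isotropy hH_incl hH_conn κ h)) hL
  have hU : ∀ L ∈ spaceU κ τ, S.dRep τ L ∈ spaceU κ τ ∧ S.dTildeRep τ L ∈ spaceU κ τ :=
    fun L hL => dRep_dTildeRep_mem_spaceU κ hd ht hL
  have hp : ∀ L, S.pRep τ L = Complex.I •
      (S.dTildeRep τ (S.dRep τ L) - S.dRep τ (S.dTildeRep τ L)) := fun L => rfl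
  have hPU : ∀ L ∈ spaceU κ τ, S.pRep τ L ∈ spaceU κ τ := fun L hL => by
    rw [hp]
    exact Submodule.smul_mem _ _ (Submodule.sub_mem _ (hU _ (hU L hL).1).2 (hU _ (hU L hL).2).1)
  have hD : ∀ (v : V), ∀ L ∈ equivariantMaps κ τ,
      ∃ h : matrixField τ v L ∈ (diracD κ).domain,
        diracD κ ⟨_, h⟩ = matrixField τ v (S.dRep τ L) := fun v L hL => by
    have := dirac_matrixField κ hτ_smooth v S.omegaBar hL (by
      rw [diracRep_omegaBar]; exact hd L hL)
    rwa [diracRep_omegaBar] at this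
  have hT : ∀ (v : V), ∀ L ∈ equivariantMaps κ τ,
      ∃ h : matrixField τ v L ∈ (diracDTilde κ).domain,
        diracDTilde κ ⟨_, h⟩ = matrixField τ v (S.dTildeRep τ L) := fun v L hL => by
    have := dirac_matrixField κ hτ_smooth v S.gBar hL (by
      rw [diracRep_gBar]; exact ht L hL)
    rwa [diracRep_gBar] at this
  have hT' : ∀ (v : V), ∀ L ∈ spaceU κ τ,
      ∃ h : frobenius n τ (v ⊗ₜ[ℂ] L) ∈ (diracDTilde κ).domain,
        diracDTilde κ ⟨frobenius n τ (v ⊗ₜ[ℂ] L), h⟩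
          = frobenius n τ (v ⊗ₜ[ℂ] S.dTildeRep τ L) := fun v L hL => by
    simp only [frobenius_tmul]
    exact hT v L (spaceU_le_equivariantMaps κ τ hL)
  have hP' : ∀ (v : V), ∀ L ∈ spaceU κ τ,
      ∃ h : frobenius n τ (v ⊗ₜ[ℂ] L) ∈ (opP κ).domain,
        opP κ ⟨frobenius n τ (v ⊗ₜ[ℂ] L), h⟩
          = frobenius n τ (v ⊗ₜ[ℂ] S.pRep τ L) := fun v L hL => by
    have hL' := spaceU_le_equivariantMaps κ τ hL
    -- Each composition is defined because the intermediate map, `𝒟_τ L` or `𝒟̃_τ L`, is again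
    -- equivariant.
    have h1 := exists_smul_apply Complex.I (exists_sub_apply
      (exists_pcomp_apply (hD v L hL') (hT v _ (hd L hL')))
      (exists_pcomp_apply (hT v L hL') (hD v _ (ht L hL'))))
    have h2 : frobenius n τ (v ⊗ₜ[ℂ] S.pRep τ L) = Complex.I •
        (matrixField τ v (S.dTildeRep τ (S.dRep τ L)) -
          matrixField τ v (S.dRep τ (S.dTildeRep τ L))) := by
      rw [hp, TensorProduct.tmul_smul, map_smul, TensorProduct.tmul_sub, map_sub, frobenius_tmul,
        frobenius_tmul]
    rw [h2]
    simp only [frobenius_tmul]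
    exact h1
  exact ⟨isInvariantUnder_spaceVU κ τ _ _ (fun L hL => (hU L hL).2) hT',
    isInvariantUnder_spaceVU κ τ _ _ hPU hP',
    fun L hL => ⟨(hU L hL).1, (hU L hL).2, hPU L hL⟩,
    fun v L hL => ⟨hT' v L hL, hP' v L hL⟩⟩
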